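/- Let $(X,\mathcal A,\mu)$ be a $\sigma$-finite measure space with $\mu(X)=\infty$, let $T:X\to X$ be a conservative, ergodic, measure-preserving transformation of $(X,\mathcal A,\mu)$, and let $Y\in\mathcal A$ with $0<\mu(Y)<\infty$. For a non-negative measurable function $u$ let $\mu_u(A)=\int_A u\,d\mu$ $(A\in\mathcal A)$, and let $\hat T u=d(\mu_u\circ T^{-1})/d\mu$ be the transfer operator. Put $$Y_0=Y,\qquad Y_n=T^{-n}Y\setminus\bigcup_{k=0}^{n-1}T^{-k}Y\quad(n\ge 1),\qquad w_n^Y=\mu\Big(\bigcup_{k=0}^{n-1}T^{-k}Y\Big),$$ $$Z_n^Y(x)=\max\{k\le n: k\ge 0,\ T^kx\in Y\}\qquad(\max\emptyset=0).$$ Assume that: (i) there are $\alpha\in(0,1)$ and a positive measurable function $\ell:(0,\infty)\to(0,\infty)$, slowly varying at $\infty$ (that is, $\ell(rt)/\ell(t)\to1$ as $t\to\infty$ for every $r>0$), such that $w_n^Y\sim n^{1-\alpha}\ell(n)$ as $n\to\infty$; (ii) there are an integer $N\ge1$, a constant $C>0$ and an integer $K\ge0$ such that for every $n\ge N$ $$C\sum_{j=0}^{K}\hat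 T^{j}\Big(\frac1{w_n^Y}\sum_{k=0}^{n-1}\hat T^k1_{Y_k}\Big)\ \ge\ 1_Y\quad\mu\text{-a.e.};$$ (iii) there is $H\in L^\infty(\mu)$ such that $\dfrac1{w_n^Y}\displaystyle\sum_{k=0}^{n-1}\hat T^k1_{Y_k}\to H$ in $L^\infty(\mu)$ as $n\to\infty$. Let $(c(n))_{n\ge0}$ be a sequence of positive numbers with $c(n)\to0$ and $c(n)\,n\to\infty$ as $n\to\infty$. Then $$\mu_H\Big(\frac{Z_n^Y}{n}\le c(n)\Big)\ \sim\ \frac{\sin(\pi\alpha)}{\pi\alpha}\,\frac{c(n)^\alpha\,\ell(n)}{\ell(c(n)n)}\qquad(n\to\infty),$$ where $a_n\sim b_n$ means $a_n/b_n\to1$. -/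

import Mathlib

open MeasureTheory Filter Topology Asymptotics
open scoped ENNReal

namespace InfiniteErgodic

/-- A positive measurable function `ℓ : (0,∞) → (0,∞)`, slowly varying at infinity.  It is encoded as
a function on `ℝ` whose values outside `(0,∞)` play no role. -/
structure IsSlowlyVarying (ℓ : ℝ → ℝ) : Prop where
  pos : ∀ t, 0 < t → 0 < ℓ t
  measurable : Measurable (fun t : Set.Ioi (0 : ℝ) => ℓ t)
  tendsto_ratio : ∀ r, 0 < r → Tendsto (fun t => ℓ (r * t) / ℓ t) atTop (𝓝 1)

section Transformation

variable {X : Type*} [MeasurableSpace X]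

/-- `T` is a conservative, ergodic, measure-preserving transformation (CEMPT) of `(X, μ)`.
Measure preservation is part of Mathlib's `Ergodic`. -/
structure IsCEMPT (T : X → X) (μ : Measure X) : Prop where
  conservative : Conservative T μ
  ergodic : Ergodic T μ

/-- The transfer operator on nonnegative functions: `u` is sent to the Radon-Nikodym density
`d(μ_u ∘ T⁻¹)/dμ`, where `μ_u` is the measure with density `u` with respect to `μ`. -/
noncomputable def transfer (T : X → X) (μ : Measure X) (u : X → ℝ≥0∞) : X → ℝ≥0∞ :=
  ((μ.withDensity u).map T).rnDeriv μ

/-- The family `𝓗` is uniformly sweeping for `G`: for some constants `C > 0` and `K`, every `H ∈ 𝓗`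
satisfies `G ≤ C * ∑_{k=0}^K T̂^k H` almost everywhere. -/
def UniformlySweeping (T : X → X) (μ : Measure X) (𝓗 : Set (X → ℝ≥0∞)) (G : X → ℝ≥0∞) : Prop :=
  ∃ C : ℝ, 0 < C ∧ ∃ K : ℕ, ∀ H ∈ 𝓗, ∀ᵐ x ∂μ,
    G x ≤ ENNReal.ofReal C * ∑ k ∈ Finset.range (K + 1), (transfer T μ)^[k] H x

/-- The set `Y_n` of points whose orbit (time `0` included) is in `Y` for the first time at time `n`;
in particular `Y_0 = Y`. -/
def entranceSet (T : X → X) (Y : Set X) (n : ℕ) : Set X :=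
  (T^[n] ⁻¹' Y) \ ⋃ k ∈ Finset.range n, T^[k] ⁻¹' Y

/-- The wandering rate `w_n = μ(⋃_{k=0}^{n-1} T^{-k} Y)`. -/
noncomputable def wanderingRate (T : X → X) (μ : Measure X) (Y : Set X) (n : ℕ) : ℝ≥0∞ :=
  μ (⋃ k ∈ Finset.range n, T^[k] ⁻¹' Y)

/-- The normalised entrance sum `(1 / w_n) * ∑_{k=0}^{n-1} T̂^k 1_{Y_k}`. -/
noncomputable def entranceAverage (T : X → X) (μ : Measure X) (Y : Set X) (n : ℕ) : X → ℝ≥0∞ :=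
  fun x => (wanderingRate T μ Y n)⁻¹ *
    ∑ k ∈ Finset.range n, (transfer T μ)^[k] ((entranceSet T Y k).indicator 1) x

/-- `H ∈ L^∞(μ)` is the asymptotic entrance density of `Y`: the limit in `L^∞(μ)` of the normalised
entrance sums. -/
structure IsAsymptoticEntranceDensity (T : X → X) (μ : Measure X) (Y : Set X) (H : X → ℝ) :
    Prop where
  memLp : MemLp H ∞ μ
  tendsto : Tendsto (fun n => eLpNorm (fun x => (entranceAverage T μ Y n x).toReal - H x) ∞ μ)
    atTop (𝓝 0)

/-- The last time `Z_n(x) = max {k ≤ n : T^k x ∈ Y}` up to `n` at which the orbit of `x` is in `Y`;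
it is `0` if there is no such time. -/
noncomputable def lastVisit (T : X → X) (Y : Set X) (n : ℕ) (x : X) : ℕ :=
  sSup {k : ℕ | k ≤ n ∧ T^[k] x ∈ Y}

/-- The measure `μ_u` with density `u ≥ 0` with respect to `μ`. -/
noncomputable def densityMeasure (μ : Measure X) (u : X → ℝ) : Measure X :=
  μ.withDensity fun x => ENNReal.ofReal (u x)

end Transformation

end InfiniteErgodic

/-!
Why the theorem holds. Write `w n` for the wandering rate, `Y_k` for the entrance sets and
`G i b = noVisit T Y i b` for the set of points not visiting `Y` in the time window `(i, i + b]`; the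
event in question is squeezed between sets `G i b` with `i` close to `c n * n` and `b ~ n`.

Points which visit `Y` in `[0, a]` but not in `(a, a + b]` have total measure `w (a + b + 1) - w b`,
because `T` preserves `μ`. Decomposing them by the time of the first visit gives the renewal identity
`∑ k ≤ a, μ (Y_k ∩ T^{-k} (G (a - k) b)) = w (a + b + 1) - w b`
(`sum_measure_entranceSet_inter_noVisit`), whose terms are the integrals of `T̂^k 1_{Y_k}` over
`G (a - k) b`. In terms of generating functions, uniform convergence of the entrance averages lets one
replace `∑ k, z ^ k T̂^k 1_{Y_k}` by `H ∑ k, z ^ k μ (Y_k)` with an error that is small compared with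
`∑ k, z ^ k μ (Y_k)` times `1_Y`, and uniform sweeping absorbs that error into the main term, because
it bounds `μ (Y ∩ G i b)` by finitely many `μ_H (G (i + j) b)`. Hence, uniformly in `b` as `z → 1`,
`∑ a, z ^ a (w (a + b + 1) - w b) ≈ (∑ k, z ^ k μ (Y_k)) (∑ i, z ^ i μ_H (G i b))`
(`exists_abs_generatingFunction_sub_le`).

The rest is regular variation. With `x = c n * n` and `z = exp (-s / x)`, the first factor on the right
is asymptotic to `Γ(2 - α) s ^ (α - 1) x ^ (1 - α) ℓ x` (`IsRegularRate.tendsto_laplace`), and the left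
side to `s ^ (-2) x ^ 2 (1 - α) n ^ (-α) ℓ n` by the monotone density theorem
(`IsRegularRate.tendsto_laplace_increment`), as `x` is small compared with `n`. This determines the
limit of the rescaled Laplace transforms of `i ↦ μ_H (G i b)`, and Karamata's Tauberian theorem
(`tendsto_sum_of_tendsto_laplace`) turns it into the asymptotics of averages of `μ_H (G i b)` over
short windows `i / x ∈ (1 - η, 1)` and `i / x ∈ (1, 1 + η)`. Monotonicity of the event in its threshold
then gives the claim. Since `ℓ` is evaluated at the real numbers `c n * n`, the uniform convergence
theorem for measurable slowly varying functions is needed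
(`IsSlowlyVarying.tendsto_ratio_of_tendsto`).
-/

namespace InfiniteErgodic

/-! ### Slowly varying functions, Riemann sums and the Tauberian theorem -/

/-- The uniform convergence theorem in additive form: `h` stands for `t ↦ log (ℓ (exp t))`. The
increments of `h` over fixed steps tend to zero pointwise, hence in measure over bounded sets of steps,
and the increment over the step `u n` is split at a point that is good for both ends. -/
theorem tendsto_sub_of_slowly_varying_additive {h : ℝ → ℝ} (hm : Measurable h)
    (hh : ∀ v, Tendsto (fun s => h (s + v) - h s) atTop (𝓝 0)) {s u : ℕ → ℝ} {u₀ : ℝ}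
    (hs : Tendsto s atTop atTop) (hu : Tendsto u atTop (𝓝 u₀)) :
    Tendsto (fun n => h (s n + u n) - h (s n)) atTop (𝓝 0) := by
  have key : ∀ (a b : ℝ) (σ : ℕ → ℝ), Tendsto σ atTop atTop →
      TendstoInMeasure (volume.restrict (Set.Icc a b)) (fun n v => h (σ n + v) - h (σ n)) atTop
        (fun _ => 0) := by
    intro a b σ hσ
    refine tendstoInMeasure_of_tendsto_ae (fun n => ?_) (Eventually.of_forall fun v => ?_)
    · exact ((hm.comp (measurable_const.add measurable_id)).sub_const _).aestronglyMeasurable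
    · exact (hh v).comp hσ
  have hsu : Tendsto (fun n => s n + u n) atTop atTop := hs.atTop_add hu
  rw [Metric.tendsto_nhds]
  intro ε hε
  have h1 := (tendstoInMeasure_iff_dist.1 (key u₀ (u₀ + 1) s hs)) (ε / 2) (half_pos hε)
  have h2 := (tendstoInMeasure_iff_dist.1 (key (-1) 2 _ hsu)) (ε / 2) (half_pos hε)
  have hpos : (0 : ℝ≥0∞) < ENNReal.ofReal (1 / 2) := by simp
  filter_upwards [h1.eventually_lt_const hpos, h2.eventually_lt_const hpos,
    Metric.tendsto_nhds.1 hu 1 one_pos] with n hn1 hn2 hn3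
  rw [Real.dist_eq, abs_lt] at hn3
  simp only [Real.dist_eq, sub_zero] at hn1 hn2 ⊢
  set B₁ := {v | ε / 2 ≤ |h (s n + v) - h (s n)|} with hB₁
  set B₂ := {v | ε / 2 ≤ |h (s n + u n + v) - h (s n + u n)|} with hB₂
  by_contra hcon
  push Not at hcon
  -- Otherwise `[u₀, u₀ + 1]` would be covered by the two small sets `B₁` and `u n + B₂`.
  have hcover : Set.Icc u₀ (u₀ + 1) ⊆
      (B₁ ∩ Set.Icc u₀ (u₀ + 1)) ∪ (fun v => v + -u n) ⁻¹' (B₂ ∩ Set.Icc (-1) 2) := by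
    intro v hv
    by_cases hv1 : v ∈ B₁
    · exact Or.inl ⟨hv1, hv⟩
    · -- if `v` is good for `s n` and `v - u n` for `s n + u n`, the claim holds at `n`
      refine Or.inr ⟨?_, ?_, ?_⟩
      · have h3 : |h (s n + v) - h (s n)| < ε / 2 := not_le.1 hv1
        have h4 : s n + u n + (v + -u n) = s n + v := by ring
        simp only [hB₂, Set.mem_ofPred_eq, h4]
        by_contra h5
        push Not at h5
        rw [abs_lt] at h3 h5
        have : |h (s n + u n) - h (s n)| < ε := by
          rw [abs_lt]; constructor <;> linarith [h3.1, h3.2, h5.1, h5.2]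
        linarith
      · linarith [hv.1]
      · linarith [hv.2]
  have hle := (measure_mono hcover).trans (measure_union_le (μ := volume) _ _)
  rw [measure_preimage_add_right, Real.volume_Icc] at hle
  rw [Measure.restrict_apply' measurableSet_Icc] at hn1 hn2
  have hlt := hle.trans_lt (ENNReal.add_lt_add hn1 hn2)
  rw [← ENNReal.ofReal_add (by norm_num) (by norm_num), ENNReal.ofReal_lt_ofReal_iff
    (by norm_num)] at hlt
  linarith

/-- The uniform convergence theorem for slowly varying functions, in sequential form: the ratio
`r` in the definition of slow variation may be replaced by a convergent sequence. -/
theorem IsSlowlyVarying.tendsto_ratio_of_tendsto {ℓ : ℝ → ℝ} (hℓ : IsSlowlyVarying ℓ)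
    {x y : ℕ → ℝ} {r : ℝ} (hr : 0 < r) (hx : Tendsto x atTop atTop)
    (hxy : Tendsto (fun n => y n / x n) atTop (𝓝 r)) :
    Tendsto (fun n => ℓ (y n) / ℓ (x n)) atTop (𝓝 1) := by
  set h : ℝ → ℝ := fun t => Real.log (ℓ (Real.exp t)) with hh
  have hm : Measurable h := by
    have : Measurable (fun t : ℝ => (⟨Real.exp t, Real.exp_pos t⟩ : Set.Ioi (0 : ℝ))) :=
      Real.measurable_exp.subtype_mk
    exact Real.measurable_log.comp (hℓ.measurable.comp this)
  have hinc : ∀ v, Tendsto (fun s => h (s + v) - h s) atTop (𝓝 0) := by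
    intro v
    have h1 := (hℓ.tendsto_ratio (Real.exp v) (Real.exp_pos v)).comp Real.tendsto_exp_atTop
    have h2 := ((Real.continuousAt_log one_ne_zero).tendsto.comp h1)
    rw [Real.log_one] at h2
    refine h2.congr fun s => ?_
    simp only [Function.comp, hh]
    rw [Real.log_div (hℓ.pos _ (by positivity)).ne' (hℓ.pos _ (by positivity)).ne', add_comm s v,
      Real.exp_add]
  have hu : Tendsto (fun n => Real.log (y n / x n)) atTop (𝓝 (Real.log r)) :=
    (Real.continuousAt_log hr.ne').tendsto.comp hxy
  have h3 := tendsto_sub_of_slowly_varying_additive hm hinc (Real.tendsto_log_atTop.comp hx) hu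
  have h4 := (Real.continuous_exp.tendsto 0).comp h3
  rw [Real.exp_zero] at h4
  refine h4.congr' ?_
  filter_upwards [hx.eventually_gt_atTop 0, hxy.eventually_const_lt hr] with n hn hn'
  have hy : 0 < y n := by
    have := mul_pos hn' hn
    rwa [div_mul_cancel₀ _ hn.ne'] at this
  simp only [Function.comp, hh]
  rw [Real.log_div hy.ne' hn.ne', add_sub_cancel, Real.exp_log hn, Real.exp_log hy, Real.exp_sub,
    Real.exp_log (hℓ.pos _ hn), Real.exp_log (hℓ.pos _ hy)]

/-- A sequence of reals, read as a step function on `(0, ∞)`, has the same integral as sum; both sides are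
zero when the sequence is not summable. -/
theorem integral_natFloor (F : ℕ → ℝ) : ∫ t in Set.Ioi (0 : ℝ), F ⌊t⌋₊ = ∑' i, F i := by
  have hmap : (volume.restrict (Set.Ici (0 : ℝ))).map (fun t : ℝ => ⌊t⌋₊) = Measure.count := by
    refine Measure.ext_iff_singleton.2 fun i => ?_
    rw [Measure.map_apply Nat.measurable_floor (measurableSet_singleton _), Measure.count_singleton,
      Measure.restrict_apply (Nat.measurable_floor (measurableSet_singleton _))]
    have : (fun t : ℝ => ⌊t⌋₊) ⁻¹' {i} ∩ Set.Ici 0 = Set.Ico (i : ℝ) (i + 1) := by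
      ext t
      simp only [Set.mem_inter_iff, Set.mem_preimage, Set.mem_singleton_iff, Set.mem_Ici,
        Set.mem_Ico]
      constructor
      · rintro ⟨h1, h2⟩; exact (Nat.floor_eq_iff h2).1 h1
      · rintro ⟨h1, h2⟩
        have h0 : 0 ≤ t := (Nat.cast_nonneg i).trans h1
        exact ⟨(Nat.floor_eq_iff h0).2 ⟨h1, h2⟩, h0⟩
    rw [this, Real.volume_Ico]; simp
  rw [← integral_Ici_eq_integral_Ioi,
    ← integral_map (μ := volume.restrict (Set.Ici (0 : ℝ))) Nat.measurable_floor.aemeasurable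
      (by rw [hmap]; exact (Measurable.of_discrete).aestronglyMeasurable), hmap]
  by_cases hF : Summable F
  · rw [integral_countable ((integrable_count_iff).2 hF.norm)]
    simp [Measure.real]
  · rw [tsum_eq_zero_of_not_summable hF, integral_undef]
    rw [integrable_count_iff]
    exact fun h => hF h.of_norm

theorem tendsto_natFloor_mul_div {x : ℕ → ℝ} (hx : Tendsto x atTop atTop) {t : ℝ} (ht : 0 ≤ t) :
    Tendsto (fun n => (⌊x n * t⌋₊ : ℝ) / x n) atTop (𝓝 t) := by
  have := (tendsto_nat_floor_mul_div_atTop (R := ℝ) ht).comp hx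
  refine this.congr fun n => ?_
  simp [mul_comm]

theorem integral_exp_mul_rpow {β s : ℝ} (hs : 0 < s) (hβ : 0 ≤ β) :
    ∫ t in Set.Ioi (0 : ℝ), Real.exp (-(s * t)) * t ^ β = Real.Gamma (β + 1) / s ^ (β + 1) := by
  have := Real.integral_rpow_mul_exp_neg_mul_Ioi (a := β + 1) (r := s) (by linarith) hs
  simp only [add_sub_cancel_right] at this
  simp only [mul_comm (Real.exp _), this]
  rw [one_div, Real.inv_rpow hs.le, div_eq_inv_mul]

theorem integrableOn_exp_mul_rpow {β s : ℝ} (hs : 0 < s) (hβ : 0 ≤ β) :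
    IntegrableOn (fun t : ℝ => Real.exp (-(s * t)) * t ^ β) (Set.Ioi 0) := by
  have := integrableOn_rpow_mul_exp_neg_mul_rpow (s := β) (p := 1) (by linarith) one_pos hs
  refine this.congr_fun (fun t _ => ?_) measurableSet_Ioi
  simp [mul_comm]

/-- Riemann sums with step `1 / x n` of a Laplace integral: if the rescaled sequences `g n` converge
pointwise to a power and grow at most linearly, then so do their Laplace transforms. -/
theorem tendsto_laplace_sum {g : ℕ → ℕ → ℝ} {x : ℕ → ℝ} {s β C : ℝ} (hs : 0 < s) (hβ : 0 ≤ β)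
    (hx : Tendsto x atTop atTop) (hbd : ∀ᶠ n in atTop, ∀ i : ℕ, |g n i| ≤ C * (1 + i / x n))
    (hlim : ∀ t : ℝ, 0 < t → Tendsto (fun n => g n ⌊x n * t⌋₊) atTop (𝓝 (t ^ β))) :
    Tendsto (fun n => (x n)⁻¹ * ∑' i : ℕ, Real.exp (-(s * (i / x n))) * g n i) atTop
      (𝓝 (Real.Gamma (β + 1) / s ^ (β + 1))) := by
  rw [← integral_exp_mul_rpow hs hβ]
  have hscale : ∀ᶠ n in atTop, ∫ t in Set.Ioi (0 : ℝ),
      Real.exp (-(s * (⌊x n * t⌋₊ / x n))) * g n ⌊x n * t⌋₊ =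
      (x n)⁻¹ * ∑' i : ℕ, Real.exp (-(s * (i / x n))) * g n i := by
    filter_upwards [hx.eventually_gt_atTop 0] with n hn
    rw [integral_comp_mul_left_Ioi (fun t => Real.exp (-(s * (⌊t⌋₊ / x n))) * g n ⌊t⌋₊) 0 hn,
      mul_zero, integral_natFloor (fun i : ℕ => Real.exp (-(s * (i / x n))) * g n i), smul_eq_mul]
  refine Tendsto.congr' hscale ?_
  -- the factor `exp s` in the bound makes up for replacing `⌊x n * t⌋₊ / x n` by `t`, once `1 ≤ x n`
  refine tendsto_integral_filter_of_dominated_convergence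
    (fun t => |C| * Real.exp s * (Real.exp (-(s * t)) * t ^ (0 : ℝ)
      + Real.exp (-(s * t)) * t ^ (1 : ℝ))) ?_ ?_ ?_ ?_
  · refine Eventually.of_forall fun n => ?_
    have : Measurable (fun t : ℝ => ⌊x n * t⌋₊) :=
      Nat.measurable_floor.comp (measurable_const.mul measurable_id)
    exact ((Measurable.of_discrete (f := fun i : ℕ =>
      Real.exp (-(s * (i / x n))) * g n i)).comp this).aestronglyMeasurable
  · filter_upwards [hbd, hx.eventually_ge_atTop 1] with n hn hx1
    refine (ae_restrict_mem measurableSet_Ioi).mono fun t (ht : 0 < t) => ?_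
    have hx0 : 0 < x n := one_pos.trans_le hx1
    have h1 : (⌊x n * t⌋₊ : ℝ) / x n ≤ t := by
      rw [div_le_iff₀ hx0, mul_comm t]; exact Nat.floor_le (by positivity)
    have h2 : t - 1 ≤ (⌊x n * t⌋₊ : ℝ) / x n := by
      rw [le_div_iff₀ hx0]
      have := Nat.lt_floor_add_one (x n * t)
      nlinarith
    have h3 : |g n ⌊x n * t⌋₊| ≤ |C| * (1 + t) := by
      refine (hn _).trans ?_
      have h0 : (0 : ℝ) ≤ ⌊x n * t⌋₊ / x n := by positivity
      calc C * (1 + ⌊x n * t⌋₊ / x n) ≤ |C| * (1 + ⌊x n * t⌋₊ / x n) := by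
            gcongr; exact le_abs_self C
        _ ≤ _ := by gcongr
    have h4 : Real.exp (-(s * (⌊x n * t⌋₊ / x n))) ≤ Real.exp s * Real.exp (-(s * t)) := by
      rw [← Real.exp_add]; apply Real.exp_le_exp.2; nlinarith
    rw [Real.norm_eq_abs, abs_mul, abs_of_pos (Real.exp_pos _)]
    calc _ ≤ (Real.exp s * Real.exp (-(s * t))) * (|C| * (1 + t)) := by gcongr
      _ = _ := by rw [Real.rpow_zero, Real.rpow_one]; ring
  · exact ((integrableOn_exp_mul_rpow hs le_rfl).add
      (integrableOn_exp_mul_rpow hs zero_le_one)).const_mul _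
  · refine (ae_restrict_mem measurableSet_Ioi).mono fun t (ht : 0 < t) => ?_
    refine Tendsto.mul ?_ (hlim t ht)
    exact (Real.continuous_exp.tendsto _).comp
      (((tendsto_natFloor_mul_div hx ht.le).const_mul s).neg)

/-- Karamata's Tauberian theorem for discrete measures: convergence of the Laplace transforms at the
positive integers to that of `A t ^ β dt` gives convergence of integrals of functions
`e ^ (-t) g (e ^ (-t))` with `g` continuous, by Weierstrass approximation of `g`. -/
theorem tendsto_sum_of_tendsto_laplace {a : ℕ → ℕ → ℝ} {x : ℕ → ℝ} {β A : ℝ} (hβ : 0 ≤ β)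
    (hx : Tendsto x atTop atTop) (ha : ∀ n i, 0 ≤ a n i)
    (hsum : ∀ᶠ n in atTop, Summable fun i : ℕ => Real.exp (-(i / x n)) * a n i)
    (hlap : ∀ k : ℕ, Tendsto (fun n => ∑' i : ℕ, Real.exp (-((k + 1 : ℝ) * (i / x n))) * a n i) atTop
      (𝓝 (A * (Real.Gamma (β + 1) / (k + 1 : ℝ) ^ (β + 1)))))
    {g : ℝ → ℝ} (hg : Continuous g) :
    Tendsto (fun n => ∑' i : ℕ, Real.exp (-(i / x n)) * g (Real.exp (-(i / x n))) * a n i) atTop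
      (𝓝 (A * ∫ t in Set.Ioi (0 : ℝ), Real.exp (-t) * g (Real.exp (-t)) * t ^ β)) := by
  set L : ℕ → (ℝ → ℝ) → ℝ := fun n f =>
    ∑' i : ℕ, Real.exp (-(i / x n)) * f (Real.exp (-(i / x n))) * a n i with hL
  set L' : (ℝ → ℝ) → ℝ := fun f =>
    ∫ t in Set.Ioi (0 : ℝ), Real.exp (-t) * f (Real.exp (-t)) * t ^ β with hL'
  have hint1 : IntegrableOn (fun t : ℝ => Real.exp (-t) * t ^ β) (Set.Ioi 0) := by
    simpa using integrableOn_exp_mul_rpow one_pos hβ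
  have hmem : ∀ t : ℝ, 0 ≤ t → Real.exp (-t) ∈ Set.Icc (0 : ℝ) 1 := fun t ht =>
    ⟨(Real.exp_pos _).le, Real.exp_le_one_iff.2 (by linarith)⟩
  have hbound : ∀ f : ℝ → ℝ, Continuous f → ∃ M, ∀ y ∈ Set.Icc (0 : ℝ) 1, |f y| ≤ M := by
    intro f hf
    obtain ⟨M, hM⟩ := isCompact_Icc.exists_bound_of_continuousOn (s := Set.Icc (0 : ℝ) 1)
      hf.continuousOn
    exact ⟨M, fun y hy => hM y hy⟩
  have hsumf : ∀ n, 0 < x n → (Summable fun i : ℕ => Real.exp (-(i / x n)) * a n i) →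
      ∀ f : ℝ → ℝ, Continuous f →
      Summable fun i : ℕ => Real.exp (-(i / x n)) * f (Real.exp (-(i / x n))) * a n i := by
    intro n hn hs f hf
    obtain ⟨M, hM⟩ := hbound f hf
    refine Summable.of_norm_bounded (hs.mul_left M) fun i => ?_
    rw [Real.norm_eq_abs, abs_mul, abs_mul, abs_of_pos (Real.exp_pos _), abs_of_nonneg (ha n i)]
    have := hM _ (hmem (i / x n) (by positivity))
    calc _ ≤ Real.exp (-(i / x n)) * M * a n i := by
          gcongr; exact ha n i
      _ = _ := by ring
  have hintf : ∀ f : ℝ → ℝ, Continuous f → IntegrableOn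
      (fun t : ℝ => Real.exp (-t) * f (Real.exp (-t)) * t ^ β) (Set.Ioi 0) := by
    intro f hf
    obtain ⟨M, hM⟩ := hbound f hf
    have h1 : IntegrableOn (fun t : ℝ => f (Real.exp (-t)) * (Real.exp (-t) * t ^ β))
        (Set.Ioi 0) := by
      refine Integrable.bdd_mul (c := M) hint1
        (hf.comp (Real.continuous_exp.comp continuous_neg)).aestronglyMeasurable ?_
      exact (ae_restrict_mem measurableSet_Ioi).mono fun t (ht : 0 < t) => hM _ (hmem t ht.le)
    refine h1.congr_fun (fun t _ => ?_) measurableSet_Ioi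
    ring
  have hmono : ∀ k : ℕ, Tendsto (fun n => L n (fun y => y ^ k)) atTop (𝓝 (A * L' fun y => y ^ k)) := by
    intro k
    have h1 : L' (fun y => y ^ k) = Real.Gamma (β + 1) / (k + 1 : ℝ) ^ (β + 1) := by
      rw [← integral_exp_mul_rpow (by positivity : (0 : ℝ) < k + 1) hβ]
      simp only [hL', ← Real.exp_nat_mul, ← Real.exp_add]
      congr 1; ext t; congr 2; ring
    rw [h1]
    refine (hlap k).congr fun n => ?_
    simp only [hL, ← Real.exp_nat_mul, ← Real.exp_add]
    congr 1; ext i; congr 2; ring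
  have hpoly : ∀ p : Polynomial ℝ, Tendsto (fun n => L n fun y => p.eval y) atTop
      (𝓝 (A * L' fun y => p.eval y)) := by
    intro p
    have h1 : L' (fun y => p.eval y) =
        ∑ k ∈ Finset.range (p.natDegree + 1), p.coeff k * L' (fun y => y ^ k) := by
      simp only [hL', ← integral_const_mul]
      rw [← integral_finsetSum _ fun k _ => (hintf (fun y => y ^ k) (by fun_prop)).const_mul _]
      congr 1; ext t
      rw [Polynomial.eval_eq_sum_range, Finset.mul_sum, Finset.sum_mul]
      exact Finset.sum_congr rfl fun k _ => by ring
    simp only [h1, Finset.mul_sum, mul_left_comm A]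
    have h2 := tendsto_finsetSum (Finset.range (p.natDegree + 1)) fun k _ =>
      (hmono k).const_mul (p.coeff k)
    refine h2.congr' ?_
    · filter_upwards [hsum, hx.eventually_gt_atTop 0] with n hn hn0
      simp only [hL, ← tsum_mul_left]
      rw [← Summable.tsum_finsetSum fun k _ => (hsumf n hn0 hn (fun y => y ^ k)
        (by fun_prop)).mul_left _]
      congr 1; ext i
      rw [Polynomial.eval_eq_sum_range, Finset.mul_sum, Finset.sum_mul]
      exact Finset.sum_congr rfl fun k _ => by ring
  have hLdiff : ∀ n, 0 < x n → (Summable fun i : ℕ => Real.exp (-(i / x n)) * a n i) →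
      ∀ f p : ℝ → ℝ, Continuous f → Continuous p → ∀ ε, (∀ y ∈ Set.Icc (0 : ℝ) 1, |p y - f y| ≤ ε) →
      |L n p - L n f| ≤ ε * L n fun y => y ^ 0 := by
    intro n hn hs f p hf hp ε hε
    simp only [hL]
    rw [← (hsumf n hn hs p hp).tsum_sub (hsumf n hn hs f hf), ← tsum_mul_left, ← Real.norm_eq_abs]
    refine tsum_of_norm_bounded ((hsumf n hn hs (fun y => y ^ 0) (by fun_prop)).mul_left ε).hasSum
      fun i => ?_
    have := hε _ (hmem (i / x n) (by positivity))
    rw [← sub_mul, ← mul_sub, Real.norm_eq_abs, abs_mul, abs_mul, abs_of_pos (Real.exp_pos _),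
      abs_of_nonneg (ha n i), pow_zero, mul_one]
    calc _ ≤ Real.exp (-(i / x n)) * ε * a n i := by
          gcongr; exact ha n i
      _ = _ := by ring
  have hL'diff : ∀ f p : ℝ → ℝ, Continuous f → Continuous p → ∀ ε,
      (∀ y ∈ Set.Icc (0 : ℝ) 1, |p y - f y| ≤ ε) → |L' p - L' f| ≤ ε * L' fun y => y ^ 0 := by
    intro f p hf hp ε hε
    simp only [hL']
    rw [← integral_sub (hintf p hp) (hintf f hf), ← integral_const_mul, ← Real.norm_eq_abs]
    refine norm_integral_le_of_norm_le ((hintf (fun y => y ^ 0) (by fun_prop)).const_mul ε) ?_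
    refine (ae_restrict_mem measurableSet_Ioi).mono fun t (ht : 0 < t) => ?_
    have := hε _ (hmem t ht.le)
    rw [← sub_mul, ← mul_sub, Real.norm_eq_abs, abs_mul, abs_mul, abs_of_pos (Real.exp_pos _),
      abs_of_nonneg (Real.rpow_nonneg ht.le β), pow_zero, mul_one]
    calc _ ≤ Real.exp (-t) * ε * t ^ β := by gcongr
      _ = _ := by ring
  change Tendsto (fun n => L n g) atTop (𝓝 (A * L' g))
  rw [Metric.tendsto_nhds]
  intro ε hε
  -- the total masses are bounded, by `D`
  set D : ℝ := |A| * |L' fun y => y ^ 0| + |A * L' fun y => y ^ 0| + 1 with hD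
  have hDpos : 0 < D := by positivity
  obtain ⟨p, hp⟩ := exists_polynomial_near_of_continuousOn 0 1 g hg.continuousOn
    (ε / (4 * D)) (by positivity)
  have hp' : ∀ y ∈ Set.Icc (0 : ℝ) 1, |p.eval y - g y| ≤ ε / (4 * D) := fun y hy => (hp y hy).le
  have hδ : ε / (4 * D) * D = ε / 4 := by field_simp
  filter_upwards [hsum, hx.eventually_gt_atTop 0, Metric.tendsto_nhds.1 (hpoly p) (ε / 4)
    (by positivity), (hmono 0).eventually_lt_const
      (show A * L' (fun y => y ^ 0) < D by
        have := le_abs_self (A * L' fun y => y ^ 0)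
        have h2 : 0 ≤ |A| * |L' fun y => y ^ 0| := by positivity
        rw [hD]; linarith)] with n hn hn0 h1 h2
  have h3 := hLdiff n hn0 hn g _ hg p.continuous _ hp'
  have h4 := hL'diff g _ hg p.continuous _ hp'
  have h5 : ε / (4 * D) * L n (fun y => y ^ 0) ≤ ε / 4 := by
    rw [← hδ]; gcongr
  have h6 : |A * L' (fun y => p.eval y) - A * L' g| ≤ ε / 4 := by
    rw [← mul_sub, abs_mul, ← hδ]
    calc |A| * |L' (fun y => p.eval y) - L' g|
        ≤ |A| * (ε / (4 * D) * |L' fun y => y ^ 0|) := by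
          gcongr; exact h4.trans (by gcongr; exact le_abs_self _)
      _ = ε / (4 * D) * (|A| * |L' fun y => y ^ 0|) := by ring
      _ ≤ _ := by
          gcongr
          have h2 : 0 ≤ |A * L' fun y => y ^ 0| := abs_nonneg _
          rw [hD]; linarith
  rw [Real.dist_eq] at h1 ⊢
  rw [abs_lt] at h1 ⊢
  rw [abs_le] at h3 h6
  constructor <;> linarith [h3.1, h3.2, h6.1, h6.2, h1.1, h1.2, h5]

/-! ### Regularly varying partial sums of monotone sequences -/

/-- Regularly varying functions have the expected ratios along sequences. -/
theorem tendsto_rpow_mul_ratio {ℓ : ℝ → ℝ} (hℓ : IsSlowlyVarying ℓ) {γ : ℝ} {x y : ℕ → ℝ} {r : ℝ}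
    (hr : 0 < r) (hx : Tendsto x atTop atTop) (hxy : Tendsto (fun n => y n / x n) atTop (𝓝 r)) :
    Tendsto (fun n => (y n ^ γ * ℓ (y n)) / (x n ^ γ * ℓ (x n))) atTop (𝓝 (r ^ γ)) := by
  have h1 := (hxy.rpow_const (Or.inl hr.ne') (p := γ)).mul (hℓ.tendsto_ratio_of_tendsto hr hx hxy)
  rw [mul_one] at h1
  refine h1.congr' ?_
  filter_upwards [hx.eventually_gt_atTop 0, hxy.eventually_const_lt hr] with n hn hn'
  have hy : 0 < y n := by
    have := mul_pos hn' hn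
    rwa [div_mul_cancel₀ _ hn.ne'] at this
  rw [Real.div_rpow hy.le hn.le, div_mul_div_comm]

/-- The partial sums `w` of a nonincreasing sequence `y ≥ 0` are regularly varying with exponent
`1 - α` and slowly varying part `ℓ`. -/
structure IsRegularRate (ℓ : ℝ → ℝ) (α : ℝ) (y w : ℕ → ℝ) : Prop where
  slowly : IsSlowlyVarying ℓ
  alpha_pos : 0 < α
  alpha_lt : α < 1
  nonneg : ∀ k, 0 ≤ y k
  antitone : Antitone y
  sum_eq : ∀ n, w n = ∑ k ∈ Finset.range n, y k
  equiv : Tendsto (fun n : ℕ => w n / ((n : ℝ) ^ (1 - α) * ℓ n)) atTop (𝓝 1)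

namespace IsRegularRate

variable {ℓ : ℝ → ℝ} {α : ℝ} {y w : ℕ → ℝ}

theorem succ (h : IsRegularRate ℓ α y w) (n : ℕ) : w (n + 1) = w n + y n := by
  rw [h.sum_eq, h.sum_eq, Finset.sum_range_succ]

theorem mono (h : IsRegularRate ℓ α y w) : Monotone w :=
  monotone_nat_of_le_succ fun n => by rw [h.succ]; linarith [h.nonneg n]

theorem rate_nonneg (h : IsRegularRate ℓ α y w) (n : ℕ) : 0 ≤ w n := by
  rw [h.sum_eq]; exact Finset.sum_nonneg fun k _ => h.nonneg k

theorem sub_le (h : IsRegularRate ℓ α y w) (a b : ℕ) : w (b + a) - w b ≤ a * y b := by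
  induction a with
  | zero => simp
  | succ a ih =>
    have := h.antitone (Nat.le_add_right b a)
    rw [← add_assoc, h.succ]; push_cast; linarith

theorem le_sub (h : IsRegularRate ℓ α y w) (a b : ℕ) : a * y (b + a) ≤ w (b + a) - w b := by
  induction a with
  | zero => simp
  | succ a ih =>
    have h1 := h.antitone (Nat.le_add_right (b + a) 1)
    rw [← add_assoc, h.succ]; push_cast
    have : (a : ℝ) * y (b + a + 1) ≤ a * y (b + a) := by gcongr
    linarith

/-- Subadditivity of `w`, iterated. -/
theorem mul_le (h : IsRegularRate ℓ α y w) (q m : ℕ) : w (q * m) ≤ q * w m := by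
  induction q with
  | zero => simp [h.sum_eq]
  | succ q ih =>
    have h1 : w ((q + 1) * m) - w (q * m) ≤ w m := by
      rw [Nat.add_mul, one_mul, h.sum_eq, h.sum_eq, h.sum_eq, Finset.sum_range_add,
        add_sub_cancel_left]
      exact Finset.sum_le_sum fun k _ => h.antitone (Nat.le_add_left k _)
    push_cast; linarith

theorem tendsto_ratio (h : IsRegularRate ℓ α y w) {x : ℕ → ℝ} {k : ℕ → ℕ} {r : ℝ} (hr : 0 < r)
    (hx : Tendsto x atTop atTop) (hk : Tendsto (fun n => (k n : ℝ) / x n) atTop (𝓝 r)) :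
    Tendsto (fun n => w (k n) / (x n ^ (1 - α) * ℓ (x n))) atTop (𝓝 (r ^ (1 - α))) := by
  have hkr : Tendsto (fun n => (k n : ℝ)) atTop atTop := by
    refine (hx.atTop_mul_pos hr hk).congr' ?_
    filter_upwards [hx.eventually_gt_atTop 0] with n hn
    field_simp
  have hkt : Tendsto k atTop atTop := tendsto_natCast_atTop_iff.1 hkr
  have h1 := (h.equiv.comp hkt).mul (tendsto_rpow_mul_ratio h.slowly (γ := 1 - α) hr hx hk)
  rw [one_mul] at h1
  refine h1.congr' ?_
  filter_upwards [hkr.eventually_gt_atTop 0] with n hn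
  have : (k n : ℝ) ^ (1 - α) * ℓ (k n) ≠ 0 :=
    (mul_pos (Real.rpow_pos_of_pos hn _) (h.slowly.pos _ hn)).ne'
  simp only [Function.comp]
  rw [div_mul_div_cancel₀ this]

/-- The monotone density theorem: `y k` is asymptotic to `(1 - α) w k / k`. -/
theorem tendsto_density (h : IsRegularRate ℓ α y w) {x : ℕ → ℝ} {k : ℕ → ℕ}
    (hx : Tendsto x atTop atTop) (hk : Tendsto (fun n => (k n : ℝ) / x n) atTop (𝓝 1)) :
    Tendsto (fun n => y (k n) * x n / (x n ^ (1 - α) * ℓ (x n))) atTop (𝓝 (1 - α)) := by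
  have hV : ∀ᶠ n in atTop, 0 < x n ^ (1 - α) * ℓ (x n) := by
    filter_upwards [hx.eventually_gt_atTop 0] with n hn
    exact mul_pos (Real.rpow_pos_of_pos hn _) (h.slowly.pos _ hn)
  have hder : HasDerivAt (fun t : ℝ => t ^ (1 - α)) (1 - α) 1 := by
    simpa using Real.hasDerivAt_rpow_const (x := 1) (p := 1 - α) (Or.inl one_ne_zero)
  have hslope := (hasDerivAt_iff_tendsto_slope_zero.1 hder)
  simp only [smul_eq_mul, Real.one_rpow] at hslope
  have hk0 := h.tendsto_ratio one_pos hx hk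
  rw [Real.one_rpow] at hk0
  rw [Metric.tendsto_nhds]
  intro ε hε
  have hev := Metric.tendsto_nhds.1 hslope (ε / 2) (half_pos hε)
  -- choose `δ` such that the difference quotients at `δ` and `-δ` are close to the derivative
  obtain ⟨δ, hδ0, hδ1, hδp, hδm⟩ : ∃ δ : ℝ, 0 < δ ∧ δ < 1 ∧
      |δ⁻¹ * ((1 + δ) ^ (1 - α) - 1) - (1 - α)| < ε / 2 ∧
      |(-δ)⁻¹ * ((1 + -δ) ^ (1 - α) - 1) - (1 - α)| < ε / 2 := by
    rw [eventually_nhdsWithin_iff, Metric.eventually_nhds_iff] at hev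
    obtain ⟨η, hη, hev⟩ := hev
    refine ⟨min (η / 2) (1 / 2), by positivity, (min_le_right _ _).trans_lt (by norm_num), ?_, ?_⟩
    · have h0 : 0 < min (η / 2) (1 / 2) := by positivity
      have := @hev (min (η / 2) (1 / 2)) (by
        rw [dist_zero_right, Real.norm_eq_abs, abs_of_pos h0]
        exact (min_le_left _ _).trans_lt (by linarith)) h0.ne'
      rwa [Real.dist_eq] at this
    · have h0 : 0 < min (η / 2) (1 / 2) := by positivity
      have := @hev (-min (η / 2) (1 / 2)) (by
        rw [dist_zero_right, Real.norm_eq_abs, abs_neg, abs_of_pos h0]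
        exact (min_le_left _ _).trans_lt (by linarith)) (neg_ne_zero.2 h0.ne')
      rwa [Real.dist_eq] at this
  -- compare `y (k n)` with the increments of `w` over the `j n` steps before and after `k n`
  set j : ℕ → ℕ := fun n => ⌊x n * δ⌋₊ with hj
  have hjx : Tendsto (fun n => (j n : ℝ) / x n) atTop (𝓝 δ) := tendsto_natFloor_mul_div hx hδ0.le
  have hxj : Tendsto (fun n => x n / (j n : ℝ)) atTop (𝓝 δ⁻¹) := by
    simpa using hjx.inv₀ hδ0.ne'
  have hjk : ∀ᶠ n in atTop, j n ≤ k n := by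
    filter_upwards [(hk.sub hjx).eventually_const_lt (sub_pos.2 hδ1), hx.eventually_gt_atTop 0]
      with n hn hn0
    rw [← sub_div, div_pos_iff_of_pos_right hn0, sub_pos] at hn
    exact_mod_cast hn.le
  have hkp : Tendsto (fun n => ((k n + j n : ℕ) : ℝ) / x n) atTop (𝓝 (1 + δ)) := by
    refine (hk.add hjx).congr fun n => ?_
    push_cast; ring
  have hkm : Tendsto (fun n => ((k n - j n : ℕ) : ℝ) / x n) atTop (𝓝 (1 + -δ)) := by
    refine (hk.add hjx.neg).congr' ?_
    filter_upwards [hjk] with n hn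
    rw [Nat.cast_sub hn]; ring
  have hup := hxj.mul (hk0.sub (h.tendsto_ratio (by linarith) hx hkm))
  have hlo := hxj.mul ((h.tendsto_ratio (by linarith) hx hkp).sub hk0)
  have hjpos : ∀ᶠ n in atTop, 0 < j n := by
    filter_upwards [hjx.eventually_const_lt hδ0] with n hn
    by_contra h0
    simp [Nat.eq_zero_of_not_pos h0] at hn
  have e1 : δ⁻¹ * (1 - (1 + -δ) ^ (1 - α)) < 1 - α + ε := by
    have h1 : δ⁻¹ * (1 - (1 + -δ) ^ (1 - α)) = (-δ)⁻¹ * ((1 + -δ) ^ (1 - α) - 1) := by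
      rw [inv_neg]; ring
    rw [h1]
    linarith [(abs_lt.1 hδm).2]
  have e2 : 1 - α - ε < δ⁻¹ * ((1 + δ) ^ (1 - α) - 1) := by linarith [(abs_lt.1 hδp).1]
  filter_upwards [hup.eventually_lt_const e1, hlo.eventually_const_lt e2, hjpos, hjk, hV,
    hx.eventually_gt_atTop 0] with n h1 h2 h3 h4 h5 h6
  have h3' : (0 : ℝ) < j n := by exact_mod_cast h3
  rw [Real.dist_eq, abs_lt]
  constructor
  · have h7 : x n / j n * (w (k n + j n) / (x n ^ (1 - α) * ℓ (x n)) -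
        w (k n) / (x n ^ (1 - α) * ℓ (x n))) ≤ y (k n) * x n / (x n ^ (1 - α) * ℓ (x n)) := by
      rw [← sub_div, div_mul_div_comm, div_le_div_iff₀ (by positivity) h5]
      have := h.sub_le (j n) (k n)
      calc _ = (w (k n + j n) - w (k n)) * (x n * (x n ^ (1 - α) * ℓ (x n))) := by ring
        _ ≤ j n * y (k n) * (x n * (x n ^ (1 - α) * ℓ (x n))) := by gcongr
        _ = _ := by ring
    linarith
  · have h7 : y (k n) * x n / (x n ^ (1 - α) * ℓ (x n)) ≤ x n / j n *
        (w (k n) / (x n ^ (1 - α) * ℓ (x n)) - w (k n - j n) / (x n ^ (1 - α) * ℓ (x n))) := by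
      rw [← sub_div, div_mul_div_comm, div_le_div_iff₀ h5 (by positivity)]
      have := h.le_sub (j n) (k n - j n)
      rw [Nat.sub_add_cancel h4] at this
      calc _ = (j n * y (k n)) * (x n * (x n ^ (1 - α) * ℓ (x n))) := by ring
        _ ≤ (w (k n) - w (k n - j n)) * (x n * (x n ^ (1 - α) * ℓ (x n))) := by gcongr
        _ = _ := by ring
    linarith

/-- Linear growth beyond the scale `x`, from subadditivity of `w`. It serves as the dominating bound
in `tendsto_laplace`. -/
theorem rate_succ_le (h : IsRegularRate ℓ α y w) {x : ℝ} (hx : 1 ≤ x) (i : ℕ) :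
    w (i + 1) ≤ 2 * (1 + i / x) * w ⌈x⌉₊ := by
  have hx0 : 0 < x := one_pos.trans_le hx
  have hm : 0 < ⌈x⌉₊ := Nat.ceil_pos.2 hx0
  have h1 : i + 1 ≤ ((i + 1) / ⌈x⌉₊ + 1) * ⌈x⌉₊ := by
    rw [mul_comm]; exact (Nat.lt_mul_div_succ (i + 1) hm).le
  refine (h.mono h1).trans ((h.mul_le _ _).trans ?_)
  have h2 : (((i + 1) / ⌈x⌉₊ + 1 : ℕ) : ℝ) ≤ 2 * (1 + i / x) := by
    have h3 : (((i + 1) / ⌈x⌉₊ : ℕ) : ℝ) ≤ ((i + 1 : ℕ) : ℝ) / ⌈x⌉₊ := Nat.cast_div_le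
    have h4 : ((i + 1 : ℕ) : ℝ) / ⌈x⌉₊ ≤ (i + 1) / x := by
      push_cast; gcongr; exact Nat.le_ceil x
    have h5 : (1 : ℝ) / x ≤ 1 := by rw [div_le_one hx0]; exact hx
    have h6 : (0 : ℝ) ≤ i / x := by positivity
    push_cast
    rw [add_div] at h4
    linarith
  exact mul_le_mul_of_nonneg_right h2 (h.rate_nonneg _)

theorem summable_exp_mul_rate (h : IsRegularRate ℓ α y w) {c : ℝ} (hc : 0 < c) :
    Summable fun i : ℕ => Real.exp (-(c * i)) * w i := by
  have h1 : Summable fun i : ℕ => y 0 * ((i : ℝ) ^ 1 * Real.exp (-c) ^ i) := by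
    have hlt : ‖Real.exp (-c)‖ < 1 := by
      rw [Real.norm_eq_abs, abs_of_pos (Real.exp_pos _), Real.exp_lt_one_iff]; linarith
    exact Summable.mul_left _ (summable_pow_mul_geometric_of_norm_lt_one (R := ℝ) 1 hlt)
  refine h1.of_nonneg_of_le (fun i => mul_nonneg (Real.exp_pos _).le (h.rate_nonneg i)) fun i => ?_
  have h2 := h.sub_le i 0
  have h0 : w 0 = 0 := by simp [h.sum_eq]
  rw [zero_add, h0, sub_zero] at h2
  rw [← Real.exp_nat_mul, pow_one]
  calc _ ≤ Real.exp (-(c * i)) * (i * y 0) := by gcongr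
    _ = _ := by rw [mul_neg, mul_comm (i : ℝ) c]; ring

theorem summable_exp_mul (h : IsRegularRate ℓ α y w) {c : ℝ} (hc : 0 < c) :
    Summable fun i : ℕ => Real.exp (-(c * i)) * y i := by
  have h1 : Summable fun i : ℕ => y 0 * Real.exp (-c) ^ i := by
    refine (summable_geometric_of_lt_one (Real.exp_pos _).le ?_).mul_left _
    rw [Real.exp_lt_one_iff]; linarith
  refine h1.of_nonneg_of_le (fun i => mul_nonneg (Real.exp_pos _).le (h.nonneg i)) fun i => ?_
  rw [← Real.exp_nat_mul, mul_neg, mul_comm (i : ℝ) c, mul_comm]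
  exact mul_le_mul_of_nonneg_right (h.antitone (Nat.zero_le i)) (Real.exp_pos _).le

/-- Summation by parts for the Laplace transform of `y`. -/
theorem tsum_exp_mul_eq (h : IsRegularRate ℓ α y w) {c : ℝ} (hc : 0 < c) :
    ∑' i : ℕ, Real.exp (-(c * i)) * y i =
      (1 - Real.exp (-c)) * ∑' i : ℕ, Real.exp (-(c * i)) * w (i + 1) := by
  have h0 : w 0 = 0 := by simp [h.sum_eq]
  have e1 : ∑' i : ℕ, Real.exp (-(c * i)) * w (i + 1) =
      ∑' i : ℕ, Real.exp (-(c * i)) * w i + ∑' i : ℕ, Real.exp (-(c * i)) * y i := by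
    rw [← (h.summable_exp_mul_rate hc).tsum_add (h.summable_exp_mul hc)]
    congr 1; ext i; rw [h.succ]; ring
  have e2 : ∑' i : ℕ, Real.exp (-(c * i)) * w i =
      Real.exp (-c) * ∑' i : ℕ, Real.exp (-(c * i)) * w (i + 1) := by
    rw [(h.summable_exp_mul_rate hc).tsum_eq_zero_add, h0, mul_zero, zero_add, ← tsum_mul_left]
    congr 1; ext i
    rw [← mul_assoc, ← Real.exp_add]; push_cast; congr 2; ring
  rw [e2] at e1
  linarith

theorem tendsto_mul_one_sub_exp {x : ℕ → ℝ} (hx : Tendsto x atTop atTop) (s : ℝ) :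
    Tendsto (fun n => x n * (1 - Real.exp (-(s / x n)))) atTop (𝓝 s) := by
  have hder : HasDerivAt (fun t : ℝ => 1 - Real.exp (-(s * t))) s 0 := by
    have h1 : HasDerivAt (fun t : ℝ => -(s * t)) (-s) 0 := by
      have := ((hasDerivAt_id (0 : ℝ)).const_mul s).neg
      rw [mul_one] at this
      exact this
    simpa using h1.exp.const_sub 1
  have h2 := hasDerivAt_iff_tendsto_slope_zero.1 hder
  have h3 : Tendsto (fun n => (x n)⁻¹) atTop (𝓝[≠] 0) := by
    refine tendsto_nhdsWithin_iff.2 ⟨tendsto_inv_atTop_zero.comp hx, ?_⟩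
    filter_upwards [hx.eventually_gt_atTop 0] with n hn
    exact inv_ne_zero hn.ne'
  refine (h2.comp h3).congr fun n => ?_
  simp [div_eq_mul_inv]

/-- The Abelian theorem for the Laplace transform of `y`. -/
theorem tendsto_laplace (h : IsRegularRate ℓ α y w) {x : ℕ → ℝ} (hx : Tendsto x atTop atTop)
    {s : ℝ} (hs : 0 < s) :
    Tendsto (fun n => (∑' i : ℕ, Real.exp (-(s / x n * i)) * y i) / (x n ^ (1 - α) * ℓ (x n))) atTop
      (𝓝 (Real.Gamma (2 - α) / s ^ (1 - α))) := by
  have hceil : Tendsto (fun n => (⌈x n⌉₊ : ℝ) / x n) atTop (𝓝 1) :=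
    (tendsto_nat_ceil_div_atTop (R := ℝ)).comp hx
  have hc1 := h.tendsto_ratio one_pos hx hceil
  rw [Real.one_rpow] at hc1
  have hV : ∀ᶠ n in atTop, 0 < x n ^ (1 - α) * ℓ (x n) := by
    filter_upwards [hx.eventually_gt_atTop 0] with n hn
    exact mul_pos (Real.rpow_pos_of_pos hn _) (h.slowly.pos _ hn)
  have hl := tendsto_laplace_sum (g := fun n i => w (i + 1) / (x n ^ (1 - α) * ℓ (x n)))
    (C := 4) hs (show 0 ≤ 1 - α by linarith [h.alpha_lt]) hx ?_ ?_
  · have hl2 := (tendsto_mul_one_sub_exp hx s).mul hl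
    have e : s * (Real.Gamma (1 - α + 1) / s ^ (1 - α + 1)) =
        Real.Gamma (2 - α) / s ^ (1 - α) := by
      rw [Real.rpow_add_one hs.ne', show 1 - α + 1 = 2 - α by ring]; field_simp
    rw [e] at hl2
    refine hl2.congr' ?_
    filter_upwards [hx.eventually_gt_atTop 0, hV] with n hn hVn
    rw [h.tsum_exp_mul_eq (by positivity : 0 < s / x n)]
    have : ∑' i : ℕ, Real.exp (-(s * (i / x n))) * (w (i + 1) / (x n ^ (1 - α) * ℓ (x n))) =
        (∑' i : ℕ, Real.exp (-(s / x n * i)) * w (i + 1)) / (x n ^ (1 - α) * ℓ (x n)) := by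
      rw [← tsum_div_const]; congr 1; ext i
      rw [show s * (i / x n) = s / x n * i by ring]; ring
    rw [this]
    field_simp
  · filter_upwards [hx.eventually_ge_atTop 1, hV, hc1.eventually_le_const one_lt_two]
      with n hn hVn hn2 i
    rw [abs_of_nonneg (div_nonneg (h.rate_nonneg _) hVn.le), div_le_iff₀ hVn]
    rw [div_le_iff₀ hVn] at hn2
    have hx0 : 0 < x n := one_pos.trans_le hn
    calc _ ≤ 2 * (1 + i / x n) * w ⌈x n⌉₊ := h.rate_succ_le hn i
      _ ≤ 2 * (1 + i / x n) * (2 * (x n ^ (1 - α) * ℓ (x n))) := by gcongr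
      _ = _ := by ring
  · intro t ht
    refine h.tendsto_ratio ht hx ?_
    have := (tendsto_natFloor_mul_div hx ht.le).add (tendsto_inv_atTop_zero.comp hx)
    rw [add_zero] at this
    refine this.congr fun n => ?_
    push_cast
    simp only [Function.comp]
    ring

/-- The Laplace transform of the increments of `w` from a starting point `b n` asymptotic to `n`, at
a scale `x n` that is small compared with `n`. -/
theorem tendsto_laplace_increment (h : IsRegularRate ℓ α y w) {x : ℕ → ℝ}
    (hx : Tendsto x atTop atTop) (hxn : Tendsto (fun n : ℕ => x n / n) atTop (𝓝 0)) {b : ℕ → ℕ}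
    (hb : Tendsto (fun n : ℕ => (b n : ℝ) / n) atTop (𝓝 1)) {s : ℝ} (hs : 0 < s) :
    Tendsto (fun n : ℕ => (∑' i : ℕ, Real.exp (-(s / x n * i)) * (w (i + b n + 1) - w (b n))) /
      (x n ^ 2 * ((1 - α) * ((n : ℝ) ^ (1 - α) * ℓ n) / n))) atTop (𝓝 (1 / s ^ 2)) := by
  have hN : Tendsto (fun n : ℕ => (n : ℝ)) atTop atTop := tendsto_natCast_atTop_atTop
  have hα : 0 < 1 - α := by linarith [h.alpha_lt]
  set d : ℕ → ℝ := fun n => (1 - α) * ((n : ℝ) ^ (1 - α) * ℓ n) / n with hd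
  have hdpos : ∀ᶠ n in atTop, 0 < d n := by
    filter_upwards [hN.eventually_gt_atTop 0] with n hn
    exact div_pos (mul_pos hα (mul_pos (Real.rpow_pos_of_pos hn _) (h.slowly.pos _ hn))) hn
  have hdens : ∀ k : ℕ → ℕ, Tendsto (fun n : ℕ => (k n : ℝ) / n) atTop (𝓝 1) →
      Tendsto (fun n => y (k n) / d n) atTop (𝓝 1) := by
    intro k hk
    have := (h.tendsto_density hN hk).div_const (1 - α)
    rw [div_self hα.ne'] at this
    refine this.congr fun n => ?_
    simp only [hd, div_eq_mul_inv, mul_inv, inv_inv]; ring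
  have hl := tendsto_laplace_sum (g := fun n i => (w (i + b n + 1) - w (b n)) / (x n * d n))
    (β := 1) (C := 2) hs zero_le_one hx ?_ ?_
  · have e : Real.Gamma (1 + 1) / s ^ ((1 : ℝ) + 1) = 1 / s ^ 2 := by
      rw [show (1 : ℝ) + 1 = 2 by norm_num, Real.Gamma_two, Real.rpow_two]
    rw [e] at hl
    refine hl.congr fun n => ?_
    have : ∑' i : ℕ, Real.exp (-(s * (i / x n))) * ((w (i + b n + 1) - w (b n)) / (x n * d n)) =
        (∑' i : ℕ, Real.exp (-(s / x n * i)) * (w (i + b n + 1) - w (b n))) / (x n * d n) := by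
      rw [← tsum_div_const]; congr 1; ext i
      rw [show s * (i / x n) = s / x n * i by ring]; ring
    rw [this]
    change _ = _ / (x n ^ 2 * d n)
    rw [inv_mul_eq_div, div_div]
    congr 1; ring
  · filter_upwards [hx.eventually_ge_atTop 1, hdpos, (hdens b hb).eventually_le_const one_lt_two]
      with n hn hdn hn2 i
    have hx0 : 0 < x n := one_pos.trans_le hn
    have h1 : 0 ≤ w (i + b n + 1) - w (b n) := sub_nonneg.2 (h.mono (by omega))
    rw [abs_of_nonneg (by positivity), div_le_iff₀ (by positivity)]
    rw [div_le_iff₀ hdn] at hn2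
    have h2 := h.sub_le (i + 1) (b n)
    rw [show b n + (i + 1) = i + b n + 1 by ring] at h2
    calc _ ≤ ((i + 1 : ℕ) : ℝ) * y (b n) := h2
      _ ≤ (i + 1 : ℕ) * (2 * d n) := by gcongr
      _ = 2 * d n * (1 + i) := by push_cast; ring
      _ ≤ 2 * d n * (x n + i) := by gcongr
      _ = _ := by field_simp
  · intro t ht
    rw [Real.rpow_one]
    have hj := tendsto_natFloor_mul_div hx ht.le
    have hj1 : Tendsto (fun n => ((⌊x n * t⌋₊ + 1 : ℕ) : ℝ) / x n) atTop (𝓝 t) := by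
      have := hj.add (tendsto_inv_atTop_zero.comp hx)
      rw [add_zero] at this
      refine this.congr fun n => ?_
      push_cast
      simp only [Function.comp]
      ring
    have hb2 : Tendsto (fun n : ℕ => ((b n + (⌊x n * t⌋₊ + 1) : ℕ) : ℝ) / n) atTop (𝓝 1) := by
      have := hb.add (hj1.mul hxn)
      rw [mul_zero, add_zero] at this
      refine this.congr' ?_
      filter_upwards [hx.eventually_gt_atTop 0] with n hn
      rw [div_mul_div_cancel₀ hn.ne']; push_cast; ring
    have hlow := hj1.mul (hdens _ hb2)
    have hupp := hj1.mul (hdens b hb)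
    rw [mul_one] at hlow hupp
    refine tendsto_of_tendsto_of_tendsto_of_le_of_le' hlow hupp ?_ ?_
    · filter_upwards [hdpos, hx.eventually_gt_atTop 0] with n hdn hn
      rw [div_mul_div_comm]
      have h2 := h.le_sub (⌊x n * t⌋₊ + 1) (b n)
      rw [show ⌊x n * t⌋₊ + b n + 1 = b n + (⌊x n * t⌋₊ + 1) by ring]
      gcongr
    · filter_upwards [hdpos, hx.eventually_gt_atTop 0] with n hdn hn
      rw [div_mul_div_comm]
      have h2 := h.sub_le (⌊x n * t⌋₊ + 1) (b n)
      rw [show ⌊x n * t⌋₊ + b n + 1 = b n + (⌊x n * t⌋₊ + 1) by ring]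
      gcongr

end IsRegularRate

/-! ### Entrance sets, the transfer operator and the renewal identity -/

section

variable {X : Type*} {T : X → X} {Y : Set X}

/-- The set of points whose orbit does not visit `Y` in the time window `(i, i + b]`. -/
def noVisit (T : X → X) (Y : Set X) (i b : ℕ) : Set X :=
  {x | ∀ j, i < j → j ≤ i + b → T^[j] x ∉ Y}

theorem mem_biUnion_range {n : ℕ} {x : X} :
    x ∈ ⋃ k ∈ Finset.range n, T^[k] ⁻¹' Y ↔ ∃ k < n, T^[k] x ∈ Y := by
  simp

theorem noVisit_eq_compl (i b : ℕ) :
    noVisit T Y i b = (T^[i + 1] ⁻¹' ⋃ k ∈ Finset.range b, T^[k] ⁻¹' Y)ᶜ := by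
  ext x
  simp only [noVisit, Set.mem_ofPred_eq, Set.mem_compl_iff, Set.mem_preimage, mem_biUnion_range,
    not_exists, not_and, ← Function.iterate_add_apply]
  constructor
  · intro h k hk
    exact h (k + (i + 1)) (by omega) (by omega)
  · intro h j h1 h2
    have := h (j - (i + 1)) (by omega)
    rwa [Nat.sub_add_cancel h1] at this

theorem preimage_noVisit (i j b : ℕ) : T^[j] ⁻¹' noVisit T Y i b = noVisit T Y (i + j) b := by
  ext x
  simp only [noVisit, Set.mem_ofPred_eq, Set.mem_preimage, ← Function.iterate_add_apply]
  constructor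
  · intro h k h1 h2
    have := h (k - j) (by omega) (by omega)
    rwa [Nat.sub_add_cancel (by omega)] at this
  · intro h k h1 h2
    exact h (k + j) (by omega) (by omega)

theorem biUnion_range_succ (n : ℕ) : ⋃ k ∈ Finset.range (n + 1), T^[k] ⁻¹' Y =
    (⋃ k ∈ Finset.range n, T^[k] ⁻¹' Y) ∪ entranceSet T Y n := by
  rw [Finset.range_add_one, Finset.set_biUnion_insert, Set.union_comm, entranceSet,
    Set.union_sdiff_self]

theorem entranceSet_zero : entranceSet T Y 0 = Y := by simp [entranceSet]

theorem entranceSet_succ_subset (n : ℕ) :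
    entranceSet T Y (n + 1) ⊆ T ⁻¹' entranceSet T Y n := by
  intro x hx
  refine ⟨hx.1, fun h => hx.2 ?_⟩
  rw [mem_biUnion_range] at h ⊢
  obtain ⟨k, hk, hk'⟩ := h
  exact ⟨k + 1, by omega, hk'⟩

variable [MeasurableSpace X] {μ : Measure X}

theorem measurableSet_biUnion_range (hT : Measurable T) (hY : MeasurableSet Y) (n : ℕ) :
    MeasurableSet (⋃ k ∈ Finset.range n, T^[k] ⁻¹' Y) :=
  Finset.measurableSet_biUnion _ fun k _ => hT.iterate k hY

theorem measurableSet_entranceSet (hT : Measurable T) (hY : MeasurableSet Y) (n : ℕ) :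
    MeasurableSet (entranceSet T Y n) :=
  (hT.iterate n hY).diff (measurableSet_biUnion_range hT hY n)

theorem measurableSet_noVisit (hT : Measurable T) (hY : MeasurableSet Y) (i b : ℕ) :
    MeasurableSet (noVisit T Y i b) := by
  rw [noVisit_eq_compl]
  exact (hT.iterate _ (measurableSet_biUnion_range hT hY b)).compl

theorem measure_biUnion_range_inter (hT : Measurable T) (hY : MeasurableSet Y) (G : Set X) (n : ℕ) :
    μ ((⋃ k ∈ Finset.range n, T^[k] ⁻¹' Y) ∩ G) =
      ∑ k ∈ Finset.range n, μ (entranceSet T Y k ∩ G) := by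
  induction n with
  | zero => simp
  | succ n ih =>
    have hA := measurableSet_biUnion_range hT hY n
    have hE := measurableSet_entranceSet hT hY n
    have hd : Disjoint (⋃ k ∈ Finset.range n, T^[k] ⁻¹' Y) (entranceSet T Y n) :=
      Set.disjoint_sdiff_right
    rw [Finset.sum_range_succ, ← ih, biUnion_range_succ, ← Measure.restrict_apply hA,
      ← Measure.restrict_apply hE, ← Measure.restrict_apply (hA.union hE), measure_union hd hE]

theorem wanderingRate_eq_sum (hT : Measurable T) (hY : MeasurableSet Y) (n : ℕ) :
    wanderingRate T μ Y n = ∑ k ∈ Finset.range n, μ (entranceSet T Y k) := by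
  have := measure_biUnion_range_inter (μ := μ) hT hY Set.univ n
  simp only [Set.inter_univ] at this
  exact this

theorem antitone_measure_entranceSet (hT : MeasurePreserving T μ μ) (hY : MeasurableSet Y) :
    Antitone fun n => μ (entranceSet T Y n) :=
  antitone_nat_of_succ_le fun n => (measure_mono (entranceSet_succ_subset n)).trans_eq
    (hT.measure_preimage (measurableSet_entranceSet hT.measurable hY n).nullMeasurableSet)

theorem measure_entranceSet_le (hT : MeasurePreserving T μ μ) (hY : MeasurableSet Y) (n : ℕ) :
    μ (entranceSet T Y n) ≤ μ Y := by
  simpa [entranceSet_zero] using antitone_measure_entranceSet hT hY (Nat.zero_le n)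

theorem wanderingRate_ne_top (hT : MeasurePreserving T μ μ) (hY : MeasurableSet Y)
    (hY_fin : μ Y < ∞) (n : ℕ) : wanderingRate T μ Y n ≠ ∞ := by
  rw [wanderingRate_eq_sum hT.measurable hY]
  exact ENNReal.sum_ne_top.2 fun k _ => ((measure_entranceSet_le hT hY k).trans_lt hY_fin).ne

/-- Points visiting `Y` in `[0, a]` and not in `(a, a + b]`, decomposed according to the first
visit. Measure preservation makes the total measure a difference of wandering rates. -/
theorem sum_measure_entranceSet_inter_noVisit (hT : MeasurePreserving T μ μ) (hY : MeasurableSet Y)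
    (a b : ℕ) :
    ∑ k ∈ Finset.range (a + 1),
      μ (entranceSet T Y k ∩ T^[k] ⁻¹' noVisit T Y (a - k) b) + wanderingRate T μ Y b =
      wanderingRate T μ Y (a + b + 1) := by
  have h1 : ∑ k ∈ Finset.range (a + 1), μ (entranceSet T Y k ∩ T^[k] ⁻¹' noVisit T Y (a - k) b) =
      μ ((⋃ k ∈ Finset.range (a + 1), T^[k] ⁻¹' Y) ∩ noVisit T Y a b) := by
    rw [measure_biUnion_range_inter hT.measurable hY]
    refine Finset.sum_congr rfl fun k hk => ?_
    rw [preimage_noVisit, Nat.sub_add_cancel (by simpa [Nat.lt_succ_iff] using hk)]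
  have hm := measurableSet_biUnion_range hT.measurable hY b
  have h2 : wanderingRate T μ Y b = μ (noVisit T Y a b)ᶜ := by
    rw [noVisit_eq_compl, compl_compl, (hT.iterate (a + 1)).measure_preimage hm.nullMeasurableSet]
    rfl
  have h3 : ⋃ k ∈ Finset.range (a + b + 1), T^[k] ⁻¹' Y =
      ((⋃ k ∈ Finset.range (a + 1), T^[k] ⁻¹' Y) ∩ noVisit T Y a b) ∪ (noVisit T Y a b)ᶜ := by
    ext x
    simp only [Set.mem_union, Set.mem_inter_iff, mem_biUnion_range, noVisit, Set.mem_ofPred_eq,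
      Set.mem_compl_iff]
    constructor
    · rintro ⟨k, hk, hk'⟩
      by_cases h : ∀ j, a < j → j ≤ a + b → T^[j] x ∉ Y
      · refine Or.inl ⟨⟨k, ?_, hk'⟩, h⟩
        by_contra hka
        exact h k (by omega) (by omega) hk'
      · exact Or.inr h
    · rintro (⟨⟨k, hk, hk'⟩, -⟩ | h)
      · exact ⟨k, by omega, hk'⟩
      · push Not at h
        obtain ⟨j, h1, h2, h3⟩ := h
        exact ⟨j, by omega, h3⟩
  rw [h1, h2, wanderingRate, h3, measure_union _ (measurableSet_noVisit hT.measurable hY a b).compl]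
  exact (disjoint_compl_right (a := noVisit T Y a b)).mono_left Set.inter_subset_right

theorem measurable_transfer_iterate (k : ℕ) {u : X → ℝ≥0∞} (hu : Measurable u) :
    Measurable ((transfer T μ)^[k] u) := by
  cases k with
  | zero => exact hu
  | succ k => rw [Function.iterate_succ_apply']; exact Measure.measurable_rnDeriv _ _

/-- The transfer operator is dual to composition with `T`. -/
theorem setLIntegral_transfer [SigmaFinite μ] (hT : MeasurePreserving T μ μ) (u : X → ℝ≥0∞)
    {G : Set X} (hG : MeasurableSet G) :
    ∫⁻ x in G, transfer T μ u x ∂μ = ∫⁻ x in T ⁻¹' G, u x ∂μ := by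
  have hac : (μ.withDensity u).map T ≪ μ := by
    have := (withDensity_absolutelyContinuous μ u).map hT.measurable
    rwa [hT.map_eq] at this
  rw [transfer, ← withDensity_apply _ hG, Measure.withDensity_rnDeriv_eq _ _ hac,
    Measure.map_apply hT.measurable hG, withDensity_apply _ (hT.measurable hG)]

theorem setLIntegral_transfer_iterate [SigmaFinite μ] (hT : MeasurePreserving T μ μ)
    (u : X → ℝ≥0∞) (k : ℕ) {G : Set X} (hG : MeasurableSet G) :
    ∫⁻ x in G, (transfer T μ)^[k] u x ∂μ = ∫⁻ x in T^[k] ⁻¹' G, u x ∂μ := by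
  induction k generalizing G with
  | zero => rfl
  | succ k ih =>
    rw [Function.iterate_succ_apply', setLIntegral_transfer hT _ hG, ih (hT.measurable hG),
      ← Set.preimage_comp, ← Function.iterate_succ']

theorem measurable_entranceAverage (hT : Measurable T) (hY : MeasurableSet Y) (n : ℕ) :
    Measurable (entranceAverage T μ Y n) :=
  measurable_const.mul (Finset.measurable_fun_sum _ fun k _ => measurable_transfer_iterate k
    (measurable_one.indicator (measurableSet_entranceSet hT hY k)))

/-- The integral of the entrance average over `G` only involves measures of sets, through duality. -/
theorem setLIntegral_entranceAverage [SigmaFinite μ] (hT : MeasurePreserving T μ μ)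
    (hY : MeasurableSet Y) (n : ℕ) {G : Set X} (hG : MeasurableSet G) :
    ∫⁻ x in G, entranceAverage T μ Y n x ∂μ = (wanderingRate T μ Y n)⁻¹ *
      ∑ k ∈ Finset.range n, μ (entranceSet T Y k ∩ T^[k] ⁻¹' G) := by
  have hm : ∀ k, Measurable ((transfer T μ)^[k] ((entranceSet T Y k).indicator 1)) := fun k =>
    measurable_transfer_iterate k
      (measurable_one.indicator (measurableSet_entranceSet hT.measurable hY k))
  unfold entranceAverage
  rw [lintegral_const_mul _ (Finset.measurable_fun_sum _ fun k _ => hm k),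
    lintegral_finsetSum _ fun k _ => hm k]
  congr 1
  refine Finset.sum_congr rfl fun k _ => ?_
  have hE := measurableSet_entranceSet hT.measurable hY k
  rw [setLIntegral_transfer_iterate hT _ k hG, lintegral_indicator_one hE,
    Measure.restrict_apply hE]

/-- The integrated form of `T̂^k 1_{Y_k} ≤ 1_Y`. -/
theorem measure_entranceSet_inter_le (hT : MeasurePreserving T μ μ) (hY : MeasurableSet Y) (k : ℕ)
    {G : Set X} (hG : MeasurableSet G) :
    μ (entranceSet T Y k ∩ T^[k] ⁻¹' G) ≤ μ (Y ∩ G) := by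
  rw [← (hT.iterate k).measure_preimage (hY.inter hG).nullMeasurableSet]
  exact measure_mono fun x hx => ⟨hx.1.1, hx.2⟩

theorem wanderingRate_ne_zero (hY_pos : 0 < μ Y) {n : ℕ} (hn : 0 < n) :
    wanderingRate T μ Y n ≠ 0 := by
  refine (hY_pos.trans_le (measure_mono ?_)).ne'
  intro x hx
  rw [mem_biUnion_range]
  exact ⟨0, hn, hx⟩

/-- The uniform convergence of the entrance averages, as a pair of almost everywhere inequalities
whose error term lives on `Y`. -/
theorem IsAsymptoticEntranceDensity.eventually_ae_le [SigmaFinite μ] (hT : MeasurePreserving T μ μ)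
    (hY : MeasurableSet Y) (hY_pos : 0 < μ Y) (hY_fin : μ Y < ∞) {H : X → ℝ}
    (hH : IsAsymptoticEntranceDensity T μ Y H) {ε : ℝ≥0∞} (hε : 0 < ε) (hε' : ε ≠ ∞) :
    ∀ᶠ n in atTop,
      (∀ᵐ x ∂μ, entranceAverage T μ Y n x ≤ ENNReal.ofReal (H x) + ε * Y.indicator 1 x) ∧
      (∀ᵐ x ∂μ, ENNReal.ofReal (H x) ≤ entranceAverage T μ Y n x + ε * Y.indicator 1 x) := by
  have hfin : ∀ n, 0 < n → ∀ᵐ x ∂μ, entranceAverage T μ Y n x < ∞ := by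
    intro n hn
    refine ae_lt_top (measurable_entranceAverage hT.measurable hY n) ?_
    have := setLIntegral_entranceAverage hT hY n MeasurableSet.univ
    rw [Measure.restrict_univ] at this
    rw [this]
    refine ENNReal.mul_ne_top (ENNReal.inv_ne_top.2 (wanderingRate_ne_zero hY_pos hn))
      (ENNReal.sum_ne_top.2 fun k _ => ?_)
    exact ((measure_entranceSet_inter_le hT hY k MeasurableSet.univ).trans_lt
      ((measure_mono Set.inter_subset_left).trans_lt hY_fin)).ne
  have hoff : ∀ n, ∀ᵐ x ∂μ, x ∉ Y → entranceAverage T μ Y n x = 0 := by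
    intro n
    have h1 := setLIntegral_entranceAverage hT hY n hY.compl
    have h2 : ∀ k ∈ Finset.range n, μ (entranceSet T Y k ∩ T^[k] ⁻¹' Yᶜ) = 0 := fun k _ => by
      have := measure_entranceSet_inter_le hT hY k hY.compl
      simpa using this
    rw [Finset.sum_eq_zero h2, mul_zero,
      lintegral_eq_zero_iff (measurable_entranceAverage hT.measurable hY n)] at h1
    exact (ae_restrict_iff' hY.compl).1 h1
  have hclose : ∀ δ : ℝ, 0 < δ → ∀ᶠ n in atTop,
      ∀ᵐ x ∂μ, |(entranceAverage T μ Y n x).toReal - H x| ≤ δ := by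
    intro δ hδ
    filter_upwards [hH.tendsto.eventually_le_const (ENNReal.ofReal_pos.2 hδ)] with n hn
    rw [eLpNorm_exponent_top] at hn
    filter_upwards [ae_le_eLpNormEssSup (μ := μ)
      (f := fun x => (entranceAverage T μ Y n x).toReal - H x)] with x hx
    have := hx.trans hn
    rwa [Real.enorm_eq_ofReal_abs, ENNReal.ofReal_le_ofReal_iff hδ.le] at this
  have hHoff : ∀ᵐ x ∂μ, x ∉ Y → H x = 0 := by
    have h1 : ∀ m : ℕ, ∀ᵐ x ∂μ, x ∉ Y → |H x| ≤ 1 / ((m : ℝ) + 1) := by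
      intro m
      obtain ⟨n, hn⟩ := (hclose (1 / ((m : ℝ) + 1)) (by positivity)).exists
      filter_upwards [hn, hoff n] with x h2 h3 hx
      simpa [h3 hx] using h2
    filter_upwards [ae_all_iff.2 h1] with x hx hxY
    have h2 : |H x| ≤ 0 := ge_of_tendsto' tendsto_one_div_add_atTop_nhds_zero_nat
      fun m => hx m hxY
    exact abs_nonpos_iff.1 h2
  filter_upwards [hclose ε.toReal (ENNReal.toReal_pos hε.ne' hε'), eventually_gt_atTop 0]
    with n hn hn0
  constructor
  · filter_upwards [hn, hoff n, hfin n hn0] with x h1 h2 h3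
    by_cases hx : x ∈ Y
    · rw [Set.indicator_of_mem hx, Pi.one_apply, mul_one, ← ENNReal.ofReal_toReal h3.ne]
      refine (ENNReal.ofReal_le_ofReal (by linarith [(abs_le.1 h1).2] :
        (entranceAverage T μ Y n x).toReal ≤ H x + ε.toReal)).trans ?_
      exact ENNReal.ofReal_add_le.trans (by rw [ENNReal.ofReal_toReal hε'])
    · rw [h2 hx]; exact zero_le
  · filter_upwards [hn, hHoff, hfin n hn0] with x h1 h2 h3
    by_cases hx : x ∈ Y
    · rw [Set.indicator_of_mem hx, Pi.one_apply, mul_one]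
      refine (ENNReal.ofReal_le_ofReal (by linarith [(abs_le.1 h1).1] :
        H x ≤ (entranceAverage T μ Y n x).toReal + ε.toReal)).trans ?_
      exact ENNReal.ofReal_add_le.trans
        (by rw [ENNReal.ofReal_toReal hε', ENNReal.ofReal_toReal h3.ne])
    · rw [h2 hx]; simp

/-- The integrated form of the convergence of the entrance averages, uniform over all sets `G`. -/
theorem IsAsymptoticEntranceDensity.eventually_measure_le [SigmaFinite μ]
    (hT : MeasurePreserving T μ μ)
    (hY : MeasurableSet Y) (hY_pos : 0 < μ Y) (hY_fin : μ Y < ∞) {H : X → ℝ}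
    (hH : IsAsymptoticEntranceDensity T μ Y H) {ε : ℝ≥0∞} (hε : 0 < ε) (hε' : ε ≠ ∞) :
    ∀ᶠ n in atTop, ∀ G, MeasurableSet G →
      ∑ k ∈ Finset.range n, μ (entranceSet T Y k ∩ T^[k] ⁻¹' G) ≤
        wanderingRate T μ Y n * (densityMeasure μ H G + ε * μ (Y ∩ G)) ∧
      wanderingRate T μ Y n * densityMeasure μ H G ≤
        ∑ k ∈ Finset.range n, μ (entranceSet T Y k ∩ T^[k] ⁻¹' G) +
          wanderingRate T μ Y n * (ε * μ (Y ∩ G)) := by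
  filter_upwards [hH.eventually_ae_le hT hY hY_pos hY_fin hε hε', eventually_gt_atTop 0]
    with n ⟨h1, h2⟩ hn G hG
  have hw0 := wanderingRate_ne_zero (T := T) hY_pos hn
  have hwt := wanderingRate_ne_top hT hY hY_fin n
  have hind : ∫⁻ x in G, ε * Y.indicator 1 x ∂μ = ε * μ (Y ∩ G) := by
    rw [lintegral_const_mul _ (measurable_one.indicator hY), lintegral_indicator_one hY,
      Measure.restrict_apply hY]
  have hmi : Measurable fun x => ε * Y.indicator (1 : X → ℝ≥0∞) x :=
    measurable_const.mul (measurable_one.indicator hY)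
  have hD : densityMeasure μ H G = ∫⁻ x in G, ENNReal.ofReal (H x) ∂μ := withDensity_apply _ hG
  have hE : ∑ k ∈ Finset.range n, μ (entranceSet T Y k ∩ T^[k] ⁻¹' G) =
      wanderingRate T μ Y n * ∫⁻ x in G, entranceAverage T μ Y n x ∂μ := by
    rw [setLIntegral_entranceAverage hT hY n hG, ← mul_assoc, ENNReal.mul_inv_cancel hw0 hwt,
      one_mul]
  rw [hE, hD, ← hind]
  constructor
  · gcongr
    rw [← lintegral_add_right _ hmi]
    exact lintegral_mono_ae (ae_restrict_of_ae h1)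
  · rw [← mul_add]
    gcongr
    rw [← lintegral_add_right _ hmi]
    exact lintegral_mono_ae (ae_restrict_of_ae h2)

/-- The same comparison for all times `n`, at the cost of an additive constant `D`. -/
theorem IsAsymptoticEntranceDensity.exists_forall_measure_le [SigmaFinite μ]
    (hT : MeasurePreserving T μ μ)
    (hY : MeasurableSet Y) (hY_pos : 0 < μ Y) (hY_fin : μ Y < ∞) {H : X → ℝ}
    (hH : IsAsymptoticEntranceDensity T μ Y H) {ε : ℝ≥0∞} (hε : 0 < ε) (hε' : ε ≠ ∞) :
    ∃ D : ℝ≥0∞, D ≠ ∞ ∧ ∀ n, ∀ G, MeasurableSet G →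
      ∑ k ∈ Finset.range n, μ (entranceSet T Y k ∩ T^[k] ⁻¹' G) ≤
        wanderingRate T μ Y n * (densityMeasure μ H G + ε * μ (Y ∩ G)) + D * μ (Y ∩ G) ∧
      wanderingRate T μ Y n * densityMeasure μ H G ≤
        ∑ k ∈ Finset.range n, μ (entranceSet T Y k ∩ T^[k] ⁻¹' G) +
          wanderingRate T μ Y n * (ε * μ (Y ∩ G)) + D * μ (Y ∩ G) := by
  obtain ⟨N, hN⟩ := eventually_atTop.1
    (hH.eventually_measure_le hT hY hY_pos hY_fin hε hε')
  have hsum : ∀ n G, MeasurableSet G → ∑ k ∈ Finset.range n, μ (entranceSet T Y k ∩ T^[k] ⁻¹' G) ≤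
      n * μ (Y ∩ G) := by
    intro n G hG
    refine (Finset.sum_le_sum fun k _ => measure_entranceSet_inter_le hT hY k hG).trans ?_
    simp
  refine ⟨N + wanderingRate T μ Y N * ε, ENNReal.add_ne_top.2 ⟨ENNReal.natCast_ne_top N,
    ENNReal.mul_ne_top (wanderingRate_ne_top hT hY hY_fin N) hε'⟩, fun n G hG => ?_⟩
  rcases le_total N n with hn | hn
  · exact ⟨(hN n hn G hG).1.trans le_self_add, (hN n hn G hG).2.trans le_self_add⟩
  · constructor
    · refine (hsum n G hG).trans (le_add_left ?_)
      rw [add_mul]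
      exact le_add_right (by gcongr)
    · refine le_add_left ?_
      have hmono : wanderingRate T μ Y n ≤ wanderingRate T μ Y N :=
        measure_mono (Set.biUnion_subset_biUnion_left fun k hk =>
          Finset.mem_coe.2 (Finset.range_mono hn hk))
      calc _ ≤ wanderingRate T μ Y N * densityMeasure μ H G := by gcongr
        _ ≤ _ := (hN N le_rfl G hG).2
        _ ≤ N * μ (Y ∩ G) + wanderingRate T μ Y N * (ε * μ (Y ∩ G)) := by
            gcongr; exact hsum N G hG
        _ = _ := by ring

/-- Uniform sweeping passes to the limit: `1_Y` is dominated by finitely many images of `H`. -/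
theorem UniformlySweeping.exists_measure_le [SigmaFinite μ] (hT : MeasurePreserving T μ μ)
    (hY : MeasurableSet Y) (hY_pos : 0 < μ Y) (hY_fin : μ Y < ∞) {H : X → ℝ}
    (hH : IsAsymptoticEntranceDensity T μ Y H) {N : ℕ}
    (hsweep : UniformlySweeping T μ (entranceAverage T μ Y '' Set.Ici N) (Y.indicator 1)) :
    ∃ C : ℝ≥0∞, C ≠ ∞ ∧ ∃ K : ℕ, ∀ G, MeasurableSet G →
      μ (Y ∩ G) ≤ C * ∑ j ∈ Finset.range (K + 1), densityMeasure μ H (T^[j] ⁻¹' G) := by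
  obtain ⟨C, hC, K, hK⟩ := hsweep
  refine ⟨ENNReal.ofReal C, ENNReal.ofReal_ne_top, K, fun G hG => ?_⟩
  have hM : ENNReal.ofReal C * ((K + 1 : ℕ) * μ Y) ≠ ∞ :=
    ENNReal.mul_ne_top ENNReal.ofReal_ne_top
      (ENNReal.mul_ne_top (ENNReal.natCast_ne_top _) hY_fin.ne)
  have hkey : ∀ ε : ℝ≥0∞, 0 < ε → ε ≠ ∞ → μ (Y ∩ G) ≤ ENNReal.ofReal C *
      ∑ j ∈ Finset.range (K + 1), densityMeasure μ H (T^[j] ⁻¹' G) +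
        ε * (ENNReal.ofReal C * ((K + 1 : ℕ) * μ Y)) := by
    intro ε hε hε'
    obtain ⟨n, ⟨h1, -⟩, hn⟩ := ((hH.eventually_ae_le hT hY hY_pos hY_fin hε hε').and
      (eventually_ge_atTop N)).exists
    have hsw := hK _ ⟨n, hn, rfl⟩
    have hm : ∀ k, Measurable ((transfer T μ)^[k] (entranceAverage T μ Y n)) := fun k =>
      measurable_transfer_iterate k (measurable_entranceAverage hT.measurable hY n)
    have hmi : Measurable fun x => ε * Y.indicator (1 : X → ℝ≥0∞) x :=
      measurable_const.mul (measurable_one.indicator hY)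
    calc μ (Y ∩ G) = ∫⁻ x in G, Y.indicator 1 x ∂μ := by
          rw [lintegral_indicator_one hY, Measure.restrict_apply hY]
      _ ≤ ∫⁻ x in G, ENNReal.ofReal C * ∑ k ∈ Finset.range (K + 1),
            (transfer T μ)^[k] (entranceAverage T μ Y n) x ∂μ :=
          lintegral_mono_ae (ae_restrict_of_ae hsw)
      _ = ENNReal.ofReal C * ∑ k ∈ Finset.range (K + 1),
            ∫⁻ x in T^[k] ⁻¹' G, entranceAverage T μ Y n x ∂μ := by
          rw [lintegral_const_mul _ (Finset.measurable_fun_sum _ fun k _ => hm k),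
            lintegral_finsetSum _ fun k _ => hm k]
          simp only [setLIntegral_transfer_iterate hT _ _ hG]
      _ ≤ ENNReal.ofReal C * ∑ k ∈ Finset.range (K + 1),
            (densityMeasure μ H (T^[k] ⁻¹' G) + ε * μ Y) := by
          gcongr with k
          have hGk := hT.measurable.iterate k hG
          calc _ ≤ ∫⁻ x in T^[k] ⁻¹' G, (ENNReal.ofReal (H x) + ε * Y.indicator 1 x) ∂μ :=
                lintegral_mono_ae (ae_restrict_of_ae h1)
            _ = densityMeasure μ H (T^[k] ⁻¹' G) + ε * μ (Y ∩ T^[k] ⁻¹' G) := by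
                rw [lintegral_add_right _ hmi, densityMeasure, withDensity_apply _ hGk,
                  lintegral_const_mul _ (measurable_one.indicator hY), lintegral_indicator_one hY,
                  Measure.restrict_apply hY]
            _ ≤ _ := by gcongr; exact Set.inter_subset_left
      _ = _ := by
          rw [Finset.sum_add_distrib, Finset.sum_const, Finset.card_range, nsmul_eq_mul]; ring
  set M := ENNReal.ofReal C * ((K + 1 : ℕ) * μ Y) with hMdef
  refine ENNReal.le_of_forall_pos_le_add fun δ hδ _ => ?_
  refine (hkey (δ / (M + 1)) (ENNReal.div_pos (by simpa using hδ.ne') (by simp [hM]))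
    (ENNReal.div_ne_top (by simp) (by simp))).trans ?_
  gcongr
  calc δ / (M + 1) * M ≤ δ / (M + 1) * (M + 1) := by gcongr; exact le_self_add
    _ = δ := ENNReal.div_mul_cancel (by simp) (by simp [hM])

end

/-! ### Generating functions -/

/-- The Cauchy product rearrangement of a double series. -/
theorem tsum_sum_range_sub (f : ℕ → ℕ → ℝ≥0∞) :
    ∑' n, ∑ k ∈ Finset.range (n + 1), f k (n - k) = ∑' k, ∑' i, f k i := by
  rw [← ENNReal.tsum_prod, ← Finset.HasAntidiagonal.sigmaAntidiagonalEquivProd.tsum_eq,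
    ENNReal.tsum_sigma']
  refine tsum_congr fun n => ?_
  rw [← Finset.Nat.sum_antidiagonal_eq_sum_range_succ f, tsum_fintype]
  exact (Finset.sum_coe_sort (Finset.HasAntidiagonal.antidiagonal n) fun ij => f ij.1 ij.2).symm

/-- Abel summation: a comparison of partial sums carries over to power series. -/
theorem tsum_pow_mul_le_of_sum_le {u v : ℕ → ℝ≥0∞} {D z : ℝ≥0∞} (hz : z < 1)
    (h : ∀ n, ∑ k ∈ Finset.range n, u k ≤ ∑ k ∈ Finset.range n, v k + D) :
    ∑' k, z ^ k * u k ≤ ∑' k, z ^ k * v k + D := by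
  have hg : ∀ u : ℕ → ℝ≥0∞, (∑' i, z ^ i) * ∑' k, z ^ k * u k =
      ∑' n, z ^ n * ∑ k ∈ Finset.range (n + 1), u k := by
    intro u
    rw [← ENNReal.tsum_mul_left]
    simp only [← ENNReal.tsum_mul_right]
    rw [← tsum_sum_range_sub fun k i => z ^ i * (z ^ k * u k)]
    refine tsum_congr fun n => ?_
    rw [Finset.mul_sum]
    refine Finset.sum_congr rfl fun k hk => ?_
    rw [← mul_assoc, ← pow_add, Nat.sub_add_cancel (by simpa [Nat.lt_succ_iff] using hk)]
  have hg0 : ∑' i, z ^ i ≠ 0 := by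
    rw [ENNReal.tsum_geometric, ENNReal.inv_ne_zero]
    exact (tsub_le_self.trans_lt ENNReal.one_lt_top).ne
  have hgt : ∑' i, z ^ i ≠ ∞ := by
    rw [ENNReal.tsum_geometric, ENNReal.inv_ne_top]
    exact (tsub_pos_of_lt hz).ne'
  rw [← ENNReal.mul_le_mul_iff_right hg0 hgt, mul_add, hg, hg, ← ENNReal.tsum_mul_right,
    ← ENNReal.tsum_add]
  refine ENNReal.tsum_le_tsum fun n => ?_
  rw [← mul_add]
  gcongr
  exact h (n + 1)

/-- A shift of the index by `j` costs a factor `z ^ (-j) ≤ 2 ^ j`. -/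
theorem tsum_pow_mul_add_le {p : ℕ → ℝ≥0∞} {z : ℝ≥0∞} (hz2 : 2⁻¹ ≤ z) (j : ℕ) :
    ∑' i, z ^ i * p (i + j) ≤ 2 ^ j * ∑' i, z ^ i * p i := by
  have h1 : ∀ i, z ^ i * p (i + j) ≤ 2 ^ j * (z ^ (i + j) * p (i + j)) := by
    intro i
    have h2 : (1 : ℝ≥0∞) ≤ 2 ^ j * z ^ j := by
      rw [← mul_pow]
      refine one_le_pow₀ ?_
      calc (1 : ℝ≥0∞) = 2 * 2⁻¹ := (ENNReal.mul_inv_cancel (by simp) (by simp)).symm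
        _ ≤ _ := by gcongr
    calc z ^ i * p (i + j) = 1 * (z ^ i * p (i + j)) := (one_mul _).symm
      _ ≤ (2 ^ j * z ^ j) * (z ^ i * p (i + j)) := by gcongr
      _ = _ := by rw [pow_add]; ring
  refine (ENNReal.tsum_le_tsum h1).trans ?_
  rw [ENNReal.tsum_mul_left]
  exact mul_le_mul_right (ENNReal.tsum_comp_le_tsum_of_injective (add_left_injective j)
    fun i => z ^ i * p i) _

theorem tsum_pow_mul_linear (z c d : ℝ≥0∞) (f g : ℕ → ℝ≥0∞) :
    ∑' i, z ^ i * (c * f i + d * g i) = c * ∑' i, z ^ i * f i + d * ∑' i, z ^ i * g i := by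
  rw [← ENNReal.tsum_mul_left, ← ENNReal.tsum_mul_left, ← ENNReal.tsum_add]
  exact tsum_congr fun i => by ring

section

variable {X : Type*} [MeasurableSpace X] {μ : Measure X} [SigmaFinite μ] {T : X → X} {Y : Set X}

/-- `H` is integrable: its integral is comparable with that of an entrance average, up to a multiple
of `μ Y`. -/
theorem IsAsymptoticEntranceDensity.isFiniteMeasure (hT : MeasurePreserving T μ μ)
    (hY : MeasurableSet Y) (hY_pos : 0 < μ Y) (hY_fin : μ Y < ∞) {H : X → ℝ}
    (hH : IsAsymptoticEntranceDensity T μ Y H) : IsFiniteMeasure (densityMeasure μ H) := by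
  obtain ⟨n, h, hn⟩ := ((hH.eventually_measure_le hT hY hY_pos hY_fin one_pos
    ENNReal.one_ne_top).and (eventually_gt_atTop 0)).exists
  have h2 := (h _ MeasurableSet.univ).2
  refine ⟨?_⟩
  by_contra htop
  rw [not_lt, top_le_iff] at htop
  rw [htop, ENNReal.mul_top (wanderingRate_ne_zero hY_pos hn), top_le_iff] at h2
  refine ENNReal.add_ne_top.2 ⟨ENNReal.sum_ne_top.2 fun k _ => ?_, ?_⟩ h2
  · exact ((measure_mono Set.inter_subset_left).trans_lt
      ((measure_entranceSet_le hT hY k).trans_lt hY_fin)).ne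
  · rw [Set.inter_univ, one_mul]
    exact ENNReal.mul_ne_top (wanderingRate_ne_top hT hY hY_fin n) hY_fin.ne

/-- The renewal identity in generating function form, up to a relative error that is small
uniformly in the length `b` of the window: the generating function of the
increments `w (a + b + 1) - w b` is almost the product of those of `μ (Y_k)` and of
`μ_H (noVisit i b)`. -/
theorem exists_abs_generatingFunction_sub_le (hT : MeasurePreserving T μ μ)
    (hY : MeasurableSet Y) (hY_pos : 0 < μ Y) (hY_fin : μ Y < ∞) {H : X → ℝ}
    (hH : IsAsymptoticEntranceDensity T μ Y H) {N : ℕ}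
    (hsweep : UniformlySweeping T μ (entranceAverage T μ Y '' Set.Ici N) (Y.indicator 1)) :
    ∃ C : ℝ, 0 ≤ C ∧ ∀ ε : ℝ, 0 < ε → ∃ D : ℝ, 0 ≤ D ∧ ∀ z : ℝ, 2⁻¹ ≤ z → z < 1 → ∀ b : ℕ,
      Summable (fun i => z ^ i * (densityMeasure μ H).real (noVisit T Y i b)) ∧
      |∑' a, z ^ a * ((wanderingRate T μ Y (a + b + 1)).toReal - (wanderingRate T μ Y b).toReal) -
        (∑' k, z ^ k * (μ (entranceSet T Y k)).toReal) *
          ∑' i, z ^ i * (densityMeasure μ H).real (noVisit T Y i b)| ≤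
      (ε * ∑' k, z ^ k * (μ (entranceSet T Y k)).toReal + D) *
        (C * ∑' i, z ^ i * (densityMeasure μ H).real (noVisit T Y i b)) := by
  obtain ⟨C, hC, K, hK⟩ := hsweep.exists_measure_le hT hY hY_pos hY_fin hH
  have hfin := hH.isFiniteMeasure hT hY hY_pos hY_fin
  set C' : ℝ≥0∞ := C * ∑ j ∈ Finset.range (K + 1), 2 ^ j with hC'
  have hC't : C' ≠ ∞ := ENNReal.mul_ne_top hC (ENNReal.sum_ne_top.2 fun j _ => by simp)
  refine ⟨C'.toReal, ENNReal.toReal_nonneg, fun ε hε => ?_⟩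
  obtain ⟨D, hD, hDle⟩ := hH.exists_forall_measure_le hT hY hY_pos hY_fin
    (ENNReal.ofReal_pos.2 hε) ENNReal.ofReal_ne_top
  refine ⟨D.toReal, ENNReal.toReal_nonneg, fun z hz2 hz1 b => ?_⟩
  have hz0 : 0 ≤ z := le_trans (by norm_num) hz2
  set ζ : ℝ≥0∞ := ENNReal.ofReal z with hζ
  have hζ1 : ζ < 1 := by rw [hζ, ← ENNReal.ofReal_one]; exact (ENNReal.ofReal_lt_ofReal_iff one_pos).2 hz1
  have hζ2 : 2⁻¹ ≤ ζ := by
    rw [hζ, ← ENNReal.ofReal_ofNat, ← ENNReal.ofReal_inv_of_pos two_pos]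
    exact ENNReal.ofReal_le_ofReal hz2
  set G : ℕ → Set X := fun i => noVisit T Y i b with hG
  have hGm : ∀ i, MeasurableSet (G i) := fun i => measurableSet_noVisit hT.measurable hY i b
  set p : ℕ → ℝ≥0∞ := fun i => densityMeasure μ H (G i) with hp
  set q : ℕ → ℝ≥0∞ := fun i => μ (Y ∩ G i) with hq
  set y : ℕ → ℝ≥0∞ := fun k => μ (entranceSet T Y k) with hy
  set e : ℕ → ℕ → ℝ≥0∞ := fun k i => μ (entranceSet T Y k ∩ T^[k] ⁻¹' G i) with he
  set W := ∑' k, ζ ^ k * y k with hW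
  set P := ∑' i, ζ ^ i * p i with hP
  set Q := ∑' i, ζ ^ i * q i with hQ
  set R := ∑' a, ζ ^ a * (wanderingRate T μ Y (a + b + 1) - wanderingRate T μ Y b) with hR
  set η := ENNReal.ofReal ε with hη
  have hRe : R = ∑' i, ζ ^ i * ∑' k, ζ ^ k * e k i := by
    calc R = ∑' a, ∑ k ∈ Finset.range (a + 1), ζ ^ (a - k) * (ζ ^ k * e k (a - k)) := by
          refine tsum_congr fun a => ?_
          have h1 := ENNReal.eq_sub_of_add_eq (wanderingRate_ne_top hT hY hY_fin b)
            (sum_measure_entranceSet_inter_noVisit hT hY a b)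
          rw [← h1, Finset.mul_sum]
          refine Finset.sum_congr rfl fun k hk => ?_
          rw [← mul_assoc, ← pow_add, Nat.sub_add_cancel (by simpa [Nat.lt_succ_iff] using hk)]
      _ = ∑' k, ∑' i, ζ ^ i * (ζ ^ k * e k i) :=
          tsum_sum_range_sub fun k i => ζ ^ i * (ζ ^ k * e k i)
      _ = _ := by
          rw [ENNReal.tsum_comm]
          simp only [ENNReal.tsum_mul_left]
  have hw : ∀ n, wanderingRate T μ Y n = ∑ k ∈ Finset.range n, y k := fun n =>
    wanderingRate_eq_sum hT.measurable hY n
  have h1 : ∀ i, ∑' k, ζ ^ k * e k i ≤ W * p i + (η * W + D) * q i := by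
    intro i
    have := tsum_pow_mul_le_of_sum_le (u := fun k => e k i) (v := fun k => y k * (p i + η * q i))
      (D := D * q i) hζ1 fun n => by
        rw [← Finset.sum_mul, ← hw]; exact (hDle n (G i) (hGm i)).1
    refine this.trans_eq ?_
    simp only [← mul_assoc]
    rw [ENNReal.tsum_mul_right]; ring
  have h2 : ∀ i, W * p i ≤ ∑' k, ζ ^ k * e k i + (η * W + D) * q i := by
    intro i
    have := tsum_pow_mul_le_of_sum_le (u := fun k => y k * p i)
      (v := fun k => e k i + y k * (η * q i)) (D := D * q i) hζ1 fun n => by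
        rw [← Finset.sum_mul, Finset.sum_add_distrib, ← Finset.sum_mul, ← hw]
        exact (hDle n (G i) (hGm i)).2
    simp only [mul_add, ← mul_assoc] at this
    rw [ENNReal.tsum_mul_right, ENNReal.tsum_add, ENNReal.tsum_mul_right,
      ENNReal.tsum_mul_right] at this
    refine this.trans_eq ?_
    ring
  -- sweeping bounds the generating function of the error by that of the main term
  have hQP : Q ≤ C' * P := by
    calc Q ≤ ∑' i, ζ ^ i * (C * ∑ j ∈ Finset.range (K + 1), p (i + j)) := by
          refine ENNReal.tsum_le_tsum fun i => ?_
          gcongr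
          have := hK (G i) (hGm i)
          simp only [hG, preimage_noVisit] at this
          exact this
      _ = C * ∑ j ∈ Finset.range (K + 1), ∑' i, ζ ^ i * p (i + j) := by
          rw [← Summable.tsum_finsetSum fun _ _ => ENNReal.summable, ← ENNReal.tsum_mul_left]
          refine tsum_congr fun i => ?_
          rw [← Finset.mul_sum]; ring
      _ ≤ C * ∑ j ∈ Finset.range (K + 1), 2 ^ j * P := by
          gcongr with j; exact tsum_pow_mul_add_le hζ2 j
      _ = _ := by rw [← Finset.sum_mul, ← mul_assoc]
  have h3 : R ≤ W * P + (η * W + D) * (C' * P) := by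
    calc R ≤ ∑' i, ζ ^ i * (W * p i + (η * W + D) * q i) := by
          rw [hRe]; gcongr with i; exact h1 i
      _ = W * P + (η * W + D) * Q := tsum_pow_mul_linear ζ _ _ p q
      _ ≤ _ := by gcongr
  have h4 : W * P ≤ R + (η * W + D) * (C' * P) := by
    calc W * P = ∑' i, ζ ^ i * (W * p i) := by
          rw [hP, ← ENNReal.tsum_mul_left]; exact tsum_congr fun i => by ring
      _ ≤ ∑' i, ζ ^ i * (∑' k, ζ ^ k * e k i + (η * W + D) * q i) := by
          gcongr with i; exact h2 i
      _ = R + (η * W + D) * Q := by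
          rw [hRe]
          simpa only [one_mul] using
            tsum_pow_mul_linear ζ 1 (η * W + D) (fun i => ∑' k, ζ ^ k * e k i) q
      _ ≤ _ := by gcongr
  have hbdd : ∀ (f : ℕ → ℝ≥0∞) (M : ℝ≥0∞), M ≠ ∞ → (∀ i, f i ≤ M) → ∑' i, ζ ^ i * f i ≠ ∞ := by
    intro f M hM hf
    refine ne_top_of_le_ne_top ?_ (ENNReal.tsum_le_tsum fun i => mul_le_mul_right (hf i) (ζ ^ i))
    rw [ENNReal.tsum_mul_right, ENNReal.tsum_geometric]
    exact ENNReal.mul_ne_top (ENNReal.inv_ne_top.2 (tsub_pos_of_lt hζ1).ne') hM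
  have hPt : P ≠ ∞ := hbdd p _ (measure_ne_top _ Set.univ) fun i => measure_mono (Set.subset_univ _)
  have hWt : W ≠ ∞ := hbdd y _ hY_fin.ne fun k => measure_entranceSet_le hT hY k
  have hEt : (η * W + D) * (C' * P) ≠ ∞ :=
    ENNReal.mul_ne_top (ENNReal.add_ne_top.2 ⟨ENNReal.mul_ne_top ENNReal.ofReal_ne_top hWt, hD⟩)
      (ENNReal.mul_ne_top hC't hPt)
  have hWPt : W * P ≠ ∞ := ENNReal.mul_ne_top hWt hPt
  have hRt : R ≠ ∞ := ne_top_of_le_ne_top (ENNReal.add_ne_top.2 ⟨hWPt, hEt⟩) h3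
  have hreal : ∀ f : ℕ → ℝ≥0∞, (∀ i, f i ≠ ∞) →
      (∑' i, ζ ^ i * f i).toReal = ∑' i, z ^ i * (f i).toReal := by
    intro f hf
    rw [ENNReal.tsum_toReal_eq fun i =>
      ENNReal.mul_ne_top (ENNReal.pow_ne_top ENNReal.ofReal_ne_top) (hf i)]
    simp only [ENNReal.toReal_mul, ENNReal.toReal_pow, ENNReal.toReal_ofReal hz0]
  have hPr : P.toReal = ∑' i, z ^ i * (densityMeasure μ H).real (noVisit T Y i b) :=
    hreal p fun i => measure_ne_top _ _
  have hWr : W.toReal = ∑' k, z ^ k * (μ (entranceSet T Y k)).toReal :=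
    hreal y fun k => ((measure_entranceSet_le hT hY k).trans_lt hY_fin).ne
  have hRr : R.toReal = ∑' a, z ^ a *
      ((wanderingRate T μ Y (a + b + 1)).toReal - (wanderingRate T μ Y b).toReal) := by
    rw [hR, hreal _ fun a => ENNReal.sub_ne_top (wanderingRate_ne_top hT hY hY_fin _)]
    refine tsum_congr fun a => ?_
    rw [ENNReal.toReal_sub_of_le _ (wanderingRate_ne_top hT hY hY_fin _)]
    rw [hw, hw]
    exact Finset.sum_le_sum_of_subset (Finset.range_mono (by omega))
  refine ⟨?_, ?_⟩
  · have := ENNReal.summable_toReal hPt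
    simp only [ENNReal.toReal_mul, ENNReal.toReal_pow, ζ, ENNReal.toReal_ofReal hz0] at this
    exact this
  · rw [← hPr, ← hWr, ← hRr]
    have hEr : ((η * W + D) * (C' * P)).toReal =
        (ε * W.toReal + D.toReal) * (C'.toReal * P.toReal) := by
      rw [ENNReal.toReal_mul, ENNReal.toReal_mul, ENNReal.toReal_add
        (ENNReal.mul_ne_top ENNReal.ofReal_ne_top hWt) hD, ENNReal.toReal_mul,
        ENNReal.toReal_ofReal hε.le]
    have h5 := ENNReal.toReal_mono (ENNReal.add_ne_top.2 ⟨hWPt, hEt⟩) h3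
    have h6 := ENNReal.toReal_mono (ENNReal.add_ne_top.2 ⟨hRt, hEt⟩) h4
    rw [ENNReal.toReal_add hWPt hEt, hEr, ENNReal.toReal_mul] at h5
    rw [ENNReal.toReal_add hRt hEt, hEr, ENNReal.toReal_mul] at h6
    rw [abs_le]
    constructor <;> linarith

end

/-! ### From Laplace transforms to local averages -/

/-- A regularly varying rate with positive exponent is unbounded. -/
theorem IsRegularRate.tendsto_atTop {ℓ : ℝ → ℝ} {α : ℝ} {y w : ℕ → ℝ} (h : IsRegularRate ℓ α y w) :
    Tendsto w atTop atTop := by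
  rcases tendsto_atTop_of_monotone h.mono with h1 | ⟨L, hL⟩
  · exact h1
  exfalso
  have hN : Tendsto (fun n : ℕ => (n : ℝ)) atTop atTop := tendsto_natCast_atTop_atTop
  have h2 : Tendsto (fun n : ℕ => w (2 * n) / ((n : ℝ) ^ (1 - α) * ℓ n)) atTop
      (𝓝 (2 ^ (1 - α))) := by
    refine h.tendsto_ratio two_pos hN ?_
    refine tendsto_const_nhds.congr' ?_
    filter_upwards [eventually_gt_atTop 0] with n hn
    have : (n : ℝ) ≠ 0 := by positivity
    push_cast; field_simp
  have hpow : (1 : ℝ) < 2 ^ (1 - α) := Real.one_lt_rpow one_lt_two (by linarith [h.alpha_lt])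
  have hL0 : L ≠ 0 := by
    rintro rfl
    have h0 : ∀ n, w n = 0 := fun n =>
      le_antisymm (h.mono.ge_of_tendsto hL n) (h.rate_nonneg n)
    have := h.equiv
    simp only [h0, zero_div] at this
    exact zero_ne_one (tendsto_nhds_unique tendsto_const_nhds this)
  -- the ratio `w (2 n) / w n` would tend to `1` if `w` were bounded
  have h3 : Tendsto (fun n => w (2 * n) / w n) atTop (𝓝 1) := by
    have := (hL.comp (tendsto_id.const_mul_atTop' two_pos)).div hL hL0
    rwa [div_self hL0] at this
  have h4 := h2.div h.equiv one_ne_zero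
  rw [div_one] at h4
  have h5 : Tendsto (fun n => w (2 * n) / w n) atTop (𝓝 (2 ^ (1 - α))) := by
    refine h4.congr' ?_
    filter_upwards [hN.eventually_gt_atTop 0] with n hn
    have : (n : ℝ) ^ (1 - α) * ℓ n ≠ 0 :=
      (mul_pos (Real.rpow_pos_of_pos hn _) (h.slowly.pos _ hn)).ne'
    simp only [Pi.div_apply]
    rw [div_div_div_cancel_right₀ this]
  exact hpow.ne (tendsto_nhds_unique h3 h5)

theorem IsRegularRate.tendsto_norming_atTop {ℓ : ℝ → ℝ} {α : ℝ} {y w : ℕ → ℝ}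
    (h : IsRegularRate ℓ α y w) {x : ℕ → ℝ} (hx : Tendsto x atTop atTop) :
    Tendsto (fun n => x n ^ (1 - α) * ℓ (x n)) atTop atTop := by
  have hceil : Tendsto (fun n => (⌈x n⌉₊ : ℝ) / x n) atTop (𝓝 1) :=
    (tendsto_nat_ceil_div_atTop (R := ℝ)).comp hx
  have hc1 := (h.tendsto_ratio one_pos hx hceil).inv₀ (by simp)
  rw [Real.one_rpow, inv_one] at hc1
  have hw := h.tendsto_atTop.comp (tendsto_nat_ceil_atTop.comp hx)
  refine (hw.atTop_mul_pos one_pos hc1).congr' ?_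
  filter_upwards [hw.eventually_gt_atTop 0] with n hn
  simp only [Function.comp] at hn ⊢
  rw [inv_div, mul_div_cancel₀ _ hn.ne']

/-- If `r ≈ ω * p` up to a relative error that can be made small, then `p` converges to the quotient
of the limits of `r` and `ω`. -/
theorem tendsto_of_abs_sub_mul_le {r ω p V : ℕ → ℝ} {r₀ ω₀ C : ℝ} (hr₀ : 0 < r₀) (hω₀ : 0 < ω₀)
    (hC : 0 ≤ C) (hr : Tendsto r atTop (𝓝 r₀)) (hω : Tendsto ω atTop (𝓝 ω₀))
    (hV : Tendsto V atTop atTop) (hp : ∀ᶠ n in atTop, 0 ≤ p n)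
    (h : ∀ ε : ℝ, 0 < ε → ∃ D : ℝ, 0 ≤ D ∧
      ∀ᶠ n in atTop, |r n - ω n * p n| ≤ (ε * ω n + D / V n) * (C * p n)) :
    Tendsto p atTop (𝓝 (r₀ / ω₀)) := by
  have hppos : ∀ᶠ n in atTop, 0 < p n := by
    obtain ⟨D, -, hD⟩ := h 1 one_pos
    filter_upwards [hD, hp, hr.eventually_const_lt hr₀] with n h1 h2 h3
    refine h2.lt_of_ne fun h0 => ?_
    rw [← h0, mul_zero, mul_zero, mul_zero, sub_zero, abs_of_pos h3] at h1
    linarith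
  have hdiff : Tendsto (fun n => r n / p n - ω n) atTop (𝓝 0) := by
    rw [Metric.tendsto_nhds]
    intro δ hδ
    obtain ⟨D, hD0, hD⟩ := h (δ / (2 * (C + 1) * (ω₀ + 1))) (by positivity)
    have hDV : Tendsto (fun n => D / V n * C) atTop (𝓝 0) := by
      simpa using (hV.const_div_atTop D).mul_const C
    filter_upwards [hD, hppos, hω.eventually_lt_const (lt_add_one ω₀), hω.eventually_const_lt hω₀,
      hDV.eventually_lt_const (half_pos hδ)] with n h1 h2 h3 h4 h5
    rw [Real.dist_eq, sub_zero]
    have h6 : r n / p n - ω n = (r n - ω n * p n) / p n := by field_simp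
    rw [h6, abs_div, abs_of_pos h2, div_lt_iff₀ h2]
    refine h1.trans_lt ?_
    have h7 : δ / (2 * (C + 1) * (ω₀ + 1)) * ω n * C ≤ δ / 2 := by
      calc _ ≤ δ / (2 * (C + 1) * (ω₀ + 1)) * (ω₀ + 1) * (C + 1) := by gcongr; linarith
        _ = _ := by field_simp
    calc _ = (δ / (2 * (C + 1) * (ω₀ + 1)) * ω n * C + D / V n * C) * p n := by ring
      _ < δ * p n := by gcongr; linarith
  have hquot : Tendsto (fun n => r n / p n) atTop (𝓝 ω₀) := by
    have := hdiff.add hω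
    simpa using this
  refine (hr.div hquot hω₀.ne').congr' ?_
  filter_upwards [hppos, hr.eventually_const_lt hr₀] with n h1 h2
  simp only [Pi.div_apply]
  field_simp

/-- A continuous nonnegative function whose composition with `t ↦ e ^ (-t)` is positive exactly on
`(u, v)`. -/
noncomputable def bump (u v y : ℝ) : ℝ := max 0 ((y - Real.exp (-v)) * (Real.exp (-u) - y))

theorem continuous_bump (u v : ℝ) : Continuous (bump u v) := by
  unfold bump; fun_prop

theorem bump_nonneg (u v y : ℝ) : 0 ≤ bump u v y := le_max_left _ _

theorem bump_pos {u v t : ℝ} (h1 : u < t) (h2 : t < v) : 0 < bump u v (Real.exp (-t)) := by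
  refine lt_max_of_lt_right (mul_pos (sub_pos.2 ?_) (sub_pos.2 ?_)) <;>
    exact Real.exp_lt_exp.2 (by linarith)

theorem bump_eq_zero {u v t : ℝ} (huv : u < v) (h : t < u ∨ v < t) :
    bump u v (Real.exp (-t)) = 0 := by
  refine max_eq_left ?_
  rcases h with h | h
  · exact mul_nonpos_of_nonneg_of_nonpos (sub_nonneg.2 (Real.exp_le_exp.2 (by linarith)))
      (sub_nonpos.2 (Real.exp_le_exp.2 (by linarith)))
  · exact mul_nonpos_of_nonpos_of_nonneg (sub_nonpos.2 (Real.exp_le_exp.2 (by linarith)))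
      (sub_nonneg.2 (Real.exp_le_exp.2 (by linarith)))

theorem integrableOn_bump (u v : ℝ) {β : ℝ} (hβ : 0 ≤ β) :
    IntegrableOn (fun t => Real.exp (-t) * bump u v (Real.exp (-t)) * t ^ β) (Set.Ioi 0) := by
  obtain ⟨M, hM⟩ := isCompact_Icc.exists_bound_of_continuousOn (s := Set.Icc (0 : ℝ) 1)
    (continuous_bump u v).continuousOn
  have hint : IntegrableOn (fun t : ℝ => Real.exp (-t) * t ^ β) (Set.Ioi 0) := by
    simpa using integrableOn_exp_mul_rpow one_pos hβ
  have h1 : IntegrableOn (fun t : ℝ => bump u v (Real.exp (-t)) * (Real.exp (-t) * t ^ β))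
      (Set.Ioi 0) := by
    refine Integrable.bdd_mul (c := M) hint
      ((continuous_bump u v).comp (Real.continuous_exp.comp continuous_neg)).aestronglyMeasurable ?_
    exact (ae_restrict_mem measurableSet_Ioi).mono fun t (ht : 0 < t) =>
      hM _ ⟨(Real.exp_pos _).le, Real.exp_le_one_iff.2 (by linarith)⟩
  refine h1.congr_fun (fun t _ => ?_) measurableSet_Ioi
  ring

theorem integral_bump_pos {u v : ℝ} (hu : 0 < u) (huv : u < v) :
    0 < ∫ t in Set.Ioi (0 : ℝ), Real.exp (-t) * bump u v (Real.exp (-t)) * t ^ (0 : ℝ) := by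
  rw [setIntegral_pos_iff_support_of_nonneg_ae
    (Eventually.of_forall fun t => ?_) (integrableOn_bump u v le_rfl)]
  · refine lt_of_lt_of_le ?_ (measure_mono (s := Set.Ioo u v) fun t ht => ⟨?_, hu.trans ht.1⟩)
    · simpa using huv
    · rw [Function.mem_support, Real.rpow_zero, mul_one]
      exact (mul_pos (Real.exp_pos _) (bump_pos ht.1 ht.2)).ne'
  · simp only [Real.rpow_zero, mul_one]
    exact mul_nonneg (Real.exp_pos _).le (bump_nonneg _ _ _)

theorem summable_bump {u v x : ℝ} (huv : u < v) (hx : 0 < x) (a : ℕ → ℝ) :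
    Summable fun i : ℕ => Real.exp (-(i / x)) * bump u v (Real.exp (-(i / x))) * a i := by
  refine summable_of_ne_finset_zero (s := Finset.range (⌊v * x⌋₊ + 1)) fun i hi => ?_
  have h1 : v * x < i := by
    rw [Finset.mem_range, not_lt] at hi
    exact (Nat.lt_floor_add_one _).trans_le (by exact_mod_cast hi)
  rw [bump_eq_zero huv (Or.inr ((lt_div_iff₀ hx).2 h1)), mul_zero, zero_mul]

/-- The case of constant weights `1 / x n`; the absolute value only keeps the weights nonnegative at the
finitely many `n` with `x n < 0`. -/
theorem tendsto_tsum_bump {x : ℕ → ℝ} (hx : Tendsto x atTop atTop) (u v : ℝ) :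
    Tendsto (fun n => ∑' i : ℕ, Real.exp (-(i / x n)) * bump u v (Real.exp (-(i / x n))) * |(x n)⁻¹|)
      atTop
      (𝓝 (∫ t in Set.Ioi (0 : ℝ), Real.exp (-t) * bump u v (Real.exp (-t)) * t ^ (0 : ℝ))) := by
  have h := tendsto_sum_of_tendsto_laplace (a := fun n _ => |(x n)⁻¹|) (A := 1) le_rfl hx
    (fun n i => abs_nonneg _) ?_ (fun k => ?_) (continuous_bump u v)
  · rwa [one_mul] at h
  · filter_upwards [hx.eventually_gt_atTop 0] with n hn
    refine Summable.mul_right _ ?_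
    have : Real.exp (-(x n)⁻¹) < 1 := Real.exp_lt_one_iff.2 (by simpa using hn)
    refine (summable_geometric_of_lt_one (Real.exp_pos _).le this).congr fun i => ?_
    rw [← Real.exp_nat_mul]; congr 1; ring
  · have hk : (0 : ℝ) < k + 1 := by positivity
    have := tendsto_laplace_sum (g := fun _ _ => 1) (C := 1) hk le_rfl hx ?_ ?_
    · rw [one_mul]
      refine this.congr' ?_
      filter_upwards [hx.eventually_gt_atTop 0] with n hn
      simp only [mul_one]
      rw [abs_of_pos (inv_pos.2 hn), tsum_mul_right, mul_comm]
    · filter_upwards [hx.eventually_gt_atTop 0] with n hn i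
      rw [abs_one, one_mul]
      have : (0 : ℝ) ≤ i / x n := by positivity
      linarith
    · intro t ht
      simp

/-- The weights `1 / x n` and `a n i` have bump averages converging to those of `dt` and of
`A t ^ α dt`, so their quotient has a limit `L` lying between `A u ^ α` and `A v ^ α`. Comparing
`a n i` with a number `ψ n / x n` on the window where the bump lives therefore bounds `ψ n`
asymptotically by `L`. -/
theorem exists_bump_ratio {a : ℕ → ℕ → ℝ} {x : ℕ → ℝ} {α A : ℝ} (hα : 0 ≤ α) (hA : 0 ≤ A)
    (hx : Tendsto x atTop atTop) (ha : ∀ n i, 0 ≤ a n i)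
    (hsum : ∀ᶠ n in atTop, Summable fun i : ℕ => Real.exp (-(i / x n)) * a n i)
    (hlap : ∀ k : ℕ, Tendsto (fun n => ∑' i : ℕ, Real.exp (-((k + 1 : ℝ) * (i / x n))) * a n i) atTop
      (𝓝 (A * (Real.Gamma (α + 1) / (k + 1 : ℝ) ^ (α + 1)))))
    {u v : ℝ} (hu : 0 < u) (huv : u < v) :
    ∃ L, A * u ^ α ≤ L ∧ L ≤ A * v ^ α ∧
      ∀ (ψ : ℕ → ℝ) (B : ℝ), ((∀ᶠ n in atTop, ∀ i : ℕ, u ≤ i / x n → i / x n ≤ v →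
        ψ n / x n ≤ a n i) → L < B → ∀ᶠ n in atTop, ψ n ≤ B) ∧
      ((∀ᶠ n in atTop, ∀ i : ℕ, u ≤ i / x n → i / x n ≤ v →
        a n i ≤ ψ n / x n) → B < L → ∀ᶠ n in atTop, B ≤ ψ n) := by
  set J := ∫ t in Set.Ioi (0 : ℝ), Real.exp (-t) * bump u v (Real.exp (-t)) * t ^ (0 : ℝ) with hJ
  set J' := ∫ t in Set.Ioi (0 : ℝ), Real.exp (-t) * bump u v (Real.exp (-t)) * t ^ α with hJ'
  have hJpos : 0 < J := integral_bump_pos hu huv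
  have hb0 : ∀ t : ℝ, 0 ≤ Real.exp (-t) * bump u v (Real.exp (-t)) := fun t =>
    mul_nonneg (Real.exp_pos _).le (bump_nonneg _ _ _)
  have hJlow : u ^ α * J ≤ J' := by
    rw [hJ, hJ', ← integral_const_mul]
    refine setIntegral_mono_on ((integrableOn_bump u v le_rfl).const_mul _)
      (integrableOn_bump u v hα) measurableSet_Ioi fun t (ht : 0 < t) => ?_
    rw [Real.rpow_zero, mul_one, mul_comm]
    rcases lt_or_ge t u with h | h
    · simp [bump_eq_zero huv (Or.inl h)]
    · exact mul_le_mul_of_nonneg_left (Real.rpow_le_rpow hu.le h hα) (hb0 t)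
  have hJupp : J' ≤ v ^ α * J := by
    rw [hJ, hJ', ← integral_const_mul]
    refine setIntegral_mono_on (integrableOn_bump u v hα)
      ((integrableOn_bump u v le_rfl).const_mul _) measurableSet_Ioi fun t (ht : 0 < t) => ?_
    rw [Real.rpow_zero, mul_one, mul_comm (v ^ α)]
    rcases lt_or_ge v t with h | h
    · simp [bump_eq_zero huv (Or.inr h)]
    · exact mul_le_mul_of_nonneg_left (Real.rpow_le_rpow ht.le h hα) (hb0 t)
  have hS0 := tendsto_tsum_bump hx u v
  have hS1 := tendsto_sum_of_tendsto_laplace hα hx ha hsum hlap (continuous_bump u v)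
  have hratio := hS1.div hS0 hJpos.ne'
  refine ⟨A * J' / J, ?_, ?_, fun ψ B => ⟨fun hψ hB => ?_, fun hψ hB => ?_⟩⟩
  · rw [le_div_iff₀ hJpos, mul_assoc]; gcongr
  · rw [div_le_iff₀ hJpos, mul_assoc]; gcongr
  · filter_upwards [hψ, hratio.eventually_lt_const hB, hx.eventually_gt_atTop 0,
      hS0.eventually_const_lt hJpos] with n h1 h2 h3 h4
    refine le_trans ?_ h2.le
    rw [Pi.div_apply, le_div_iff₀ h4, ← tsum_mul_left]
    refine Summable.tsum_le_tsum (fun i => ?_)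
      ((summable_bump huv h3 fun _ => |(x n)⁻¹|).mul_left _) (summable_bump huv h3 (a n))
    by_cases h : u ≤ i / x n ∧ i / x n ≤ v
    · have := mul_le_mul_of_nonneg_left (h1 i h.1 h.2) (hb0 (i / x n))
      rw [abs_of_pos (inv_pos.2 h3)]
      calc _ = _ := by ring
        _ ≤ _ := this
    · rw [not_and_or, not_le, not_le] at h
      simp [bump_eq_zero huv h]
  · filter_upwards [hψ, hratio.eventually_const_lt hB, hx.eventually_gt_atTop 0,
      hS0.eventually_const_lt hJpos] with n h1 h2 h3 h4
    refine h2.le.trans ?_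
    rw [Pi.div_apply, div_le_iff₀ h4, ← tsum_mul_left]
    refine Summable.tsum_le_tsum (fun i => ?_) (summable_bump huv h3 (a n))
      ((summable_bump huv h3 fun _ => |(x n)⁻¹|).mul_left _)
    by_cases h : u ≤ i / x n ∧ i / x n ≤ v
    · have := mul_le_mul_of_nonneg_left (h1 i h.1 h.2) (hb0 (i / x n))
      rw [abs_of_pos (inv_pos.2 h3)]
      calc _ ≤ _ := this
        _ = _ := by ring
    · rw [not_and_or, not_le, not_le] at h
      simp [bump_eq_zero huv h]

theorem lastVisit_le_iff {X : Type*} {T : X → X} {Y : Set X} {n : ℕ} {x : X} {t : ℝ}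
    (ht : 0 ≤ t) : (lastVisit T Y n x : ℝ) ≤ t ↔ ∀ k ≤ n, T^[k] x ∈ Y → (k : ℝ) ≤ t := by
  have hbdd : BddAbove {k : ℕ | k ≤ n ∧ T^[k] x ∈ Y} := ⟨n, fun k hk => hk.1⟩
  constructor
  · intro h k hk hkY
    have : k ≤ lastVisit T Y n x := le_csSup hbdd ⟨hk, hkY⟩
    exact (Nat.cast_le.2 this).trans h
  · intro h
    rcases Set.eq_empty_or_nonempty {k : ℕ | k ≤ n ∧ T^[k] x ∈ Y} with h0 | h0
    · rw [lastVisit, h0]; simpa using ht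
    · have := Nat.sSup_mem h0 hbdd
      exact h _ this.1 this.2

/-! ### Asymptotics of the last visit -/

section

variable {X : Type*} [MeasurableSpace X] {μ : Measure X} {T : X → X} {Y : Set X}

theorem isRegularRate_wanderingRate (hT : MeasurePreserving T μ μ)
    (hY : MeasurableSet Y) (hY_fin : μ Y < ∞) {α : ℝ} (hα_pos : 0 < α) (hα_lt : α < 1)
    {ℓ : ℝ → ℝ} (hℓ : IsSlowlyVarying ℓ)
    (hw : (fun n : ℕ => (wanderingRate T μ Y n).toReal) ~[atTop]
      fun n : ℕ => (n : ℝ) ^ (1 - α) * ℓ n) :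
    IsRegularRate ℓ α (fun k => (μ (entranceSet T Y k)).toReal)
      (fun n => (wanderingRate T μ Y n).toReal) where
  slowly := hℓ
  alpha_pos := hα_pos
  alpha_lt := hα_lt
  nonneg _ := ENNReal.toReal_nonneg
  antitone := fun _ b h => ENNReal.toReal_mono
    ((measure_entranceSet_le hT hY _).trans_lt hY_fin).ne (antitone_measure_entranceSet hT hY h)
  sum_eq n := by
    rw [wanderingRate_eq_sum hT.measurable hY, ENNReal.toReal_sum fun k _ =>
      ((measure_entranceSet_le hT hY k).trans_lt hY_fin).ne]
  equiv := by
    refine (isEquivalent_iff_tendsto_one ?_).1 hw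
    filter_upwards [eventually_gt_atTop 0] with n hn
    have hn' : (0 : ℝ) < n := by exact_mod_cast hn
    exact (mul_pos (Real.rpow_pos_of_pos hn' _) (hℓ.pos _ hn')).ne'

/-- The Laplace transform, at scale `x n`, of `i ↦ μ_H (noVisit i (b n))`. -/
theorem tendsto_laplace_noVisit [SigmaFinite μ] (hT : MeasurePreserving T μ μ)
    (hY : MeasurableSet Y) (hY_pos : 0 < μ Y) (hY_fin : μ Y < ∞) {α : ℝ} {ℓ : ℝ → ℝ}
    (hreg : IsRegularRate ℓ α (fun k => (μ (entranceSet T Y k)).toReal)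
      (fun n => (wanderingRate T μ Y n).toReal)) {H : X → ℝ}
    (hH : IsAsymptoticEntranceDensity T μ Y H) {N : ℕ}
    (hsweep : UniformlySweeping T μ (entranceAverage T μ Y '' Set.Ici N) (Y.indicator 1))
    {x : ℕ → ℝ} (hx : Tendsto x atTop atTop) (hxn : Tendsto (fun n : ℕ => x n / n) atTop (𝓝 0))
    {b : ℕ → ℕ} (hb : Tendsto (fun n : ℕ => (b n : ℝ) / n) atTop (𝓝 1)) {s : ℝ} (hs : 0 < s) :
    (∀ᶠ n in atTop, Summable fun i : ℕ =>
      Real.exp (-(s * (i / x n))) * (densityMeasure μ H).real (noVisit T Y i (b n))) ∧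
    Tendsto (fun n : ℕ => (∑' i : ℕ, Real.exp (-(s * (i / x n))) *
        (densityMeasure μ H).real (noVisit T Y i (b n))) *
        ((x n ^ (1 - α) * ℓ (x n)) / (x n ^ 2 * ((1 - α) * ((n : ℝ) ^ (1 - α) * ℓ n) / n)))) atTop
      (𝓝 (1 / s ^ 2 / (Real.Gamma (2 - α) / s ^ (1 - α)))) := by
  obtain ⟨C, hC, hgen⟩ := exists_abs_generatingFunction_sub_le hT hY hY_pos hY_fin hH hsweep
  have hz : ∀ᶠ n in atTop, 2⁻¹ ≤ Real.exp (-(s / x n)) ∧ Real.exp (-(s / x n)) < 1 := by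
    have h1 : Tendsto (fun n => Real.exp (-(s / x n))) atTop (𝓝 1) := by
      have h2 := (Real.continuous_exp.tendsto _).comp (hx.const_div_atTop s).neg
      simp only [neg_zero, Real.exp_zero] at h2
      exact h2
    filter_upwards [h1.eventually_const_le (by norm_num : (2⁻¹ : ℝ) < 1),
      hx.eventually_gt_atTop 0] with n h2 h3
    exact ⟨h2, Real.exp_lt_one_iff.2 (neg_lt_zero.2 (div_pos hs h3))⟩
  have hpow : ∀ n i : ℕ, Real.exp (-(s / x n)) ^ i = Real.exp (-(s / x n * i)) := by
    intro n i; rw [← Real.exp_nat_mul]; congr 1; ring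
  have hcom : ∀ n i : ℕ, s * ((i : ℝ) / x n) = s / x n * i := fun n i => by ring
  simp only [hcom]
  constructor
  · obtain ⟨D, -, hD⟩ := hgen 1 one_pos
    filter_upwards [hz] with n hn
    have := (hD _ hn.1 hn.2 (b n)).1
    simpa only [hpow] using this
  have hd : ∀ᶠ n : ℕ in atTop, 0 < (1 - α) * ((n : ℝ) ^ (1 - α) * ℓ n) / n := by
    filter_upwards [eventually_gt_atTop 0] with n hn
    have hn' : (0 : ℝ) < n := by exact_mod_cast hn
    exact div_pos (mul_pos (by linarith [hreg.alpha_lt])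
      (mul_pos (Real.rpow_pos_of_pos hn' _) (hreg.slowly.pos _ hn'))) hn'
  have hV : ∀ᶠ n in atTop, 0 < x n ^ (1 - α) * ℓ (x n) :=
    (hreg.tendsto_norming_atTop hx).eventually_gt_atTop 0
  refine tendsto_of_abs_sub_mul_le (C := C) (by positivity)
    (div_pos (Real.Gamma_pos_of_pos (by linarith [hreg.alpha_lt])) (Real.rpow_pos_of_pos hs _)) hC
    (hreg.tendsto_laplace_increment hx hxn hb hs) (hreg.tendsto_laplace hx hs)
    (hreg.tendsto_norming_atTop hx) ?_ ?_
  · filter_upwards [hd, hV] with n hdn hVn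
    refine mul_nonneg (tsum_nonneg fun i => ?_) ?_
    · exact mul_nonneg (Real.exp_pos _).le measureReal_nonneg
    · positivity
  · intro ε hε
    obtain ⟨D, hD0, hD⟩ := hgen ε hε
    refine ⟨D, hD0, ?_⟩
    filter_upwards [hz, hd, hV, hx.eventually_gt_atTop 0] with n hn hdn hVn hxn
    have h := (hD _ hn.1 hn.2 (b n)).2
    simp only [hpow] at h
    set R := ∑' a : ℕ, Real.exp (-(s / x n * a)) *
      ((wanderingRate T μ Y (a + b n + 1)).toReal - (wanderingRate T μ Y (b n)).toReal)
    set W := ∑' k : ℕ, Real.exp (-(s / x n * k)) * (μ (entranceSet T Y k)).toReal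
    set P := ∑' i : ℕ, Real.exp (-(s / x n * i)) *
      (densityMeasure μ H).real (noVisit T Y i (b n))
    set V := x n ^ (1 - α) * ℓ (x n)
    have hE : 0 < x n ^ 2 * ((1 - α) * ((n : ℝ) ^ (1 - α) * ℓ n) / n) := by positivity
    set E := x n ^ 2 * ((1 - α) * ((n : ℝ) ^ (1 - α) * ℓ n) / n)
    have e1 : R / E - W / V * (P * (V / E)) = (R - W * P) / E := by field_simp
    have e2 : (ε * (W / V) + D / V) * (C * (P * (V / E))) = (ε * W + D) * (C * P) / E := by
      field_simp
    rw [e1, e2, abs_div, abs_of_pos hE]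
    gcongr

/-- The constant produced by the two Laplace transforms, by the reflection formula. -/
theorem gamma_constant_eq {α : ℝ} (hα_pos : 0 < α) (hα_lt : α < 1) :
    (1 - α) * (1 / (Real.Gamma (2 - α) * Real.Gamma (α + 1))) =
      Real.sin (Real.pi * α) / (Real.pi * α) := by
  have h1 : Real.Gamma (2 - α) = (1 - α) * Real.Gamma (1 - α) := by
    rw [← Real.Gamma_add_one (by linarith), show 1 - α + 1 = 2 - α by ring]
  have h2 : Real.Gamma (α + 1) = α * Real.Gamma α := Real.Gamma_add_one hα_pos.ne'
  have hsin : 0 < Real.sin (Real.pi * α) :=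
    Real.sin_pos_of_pos_of_lt_pi (by positivity) (by nlinarith [Real.pi_pos])
  have h1α : (1 - α) ≠ 0 := by linarith
  rw [h1, h2, show (1 - α) * Real.Gamma (1 - α) * (α * Real.Gamma α) =
    (1 - α) * α * (Real.Gamma α * Real.Gamma (1 - α)) by ring, Real.Gamma_mul_Gamma_one_sub]
  have := Real.pi_pos.ne'
  field_simp

end

end InfiniteErgodic

theorem mainTheorem1 {X : Type*} [MeasurableSpace X] (μ : Measure X) [SigmaFinite μ]
    (hμ : μ Set.univ = ∞)
    (T : X → X) (hT : InfiniteErgodic.IsCEMPT T μ)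
    (Y : Set X) (hY : MeasurableSet Y) (hY_pos : 0 < μ Y) (hY_fin : μ Y < ∞)
    (α : ℝ) (hα_pos : 0 < α) (hα_lt : α < 1)
    (ℓ : ℝ → ℝ) (hℓ : InfiniteErgodic.IsSlowlyVarying ℓ)
    (hw : (fun n : ℕ => (InfiniteErgodic.wanderingRate T μ Y n).toReal) ~[atTop]
      fun n : ℕ => (n : ℝ) ^ (1 - α) * ℓ n)
    (hsweep : ∃ N : ℕ, 0 < N ∧ InfiniteErgodic.UniformlySweeping T μ
      (InfiniteErgodic.entranceAverage T μ Y '' Set.Ici N) (Y.indicator 1))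
    (H : X → ℝ) (hH : InfiniteErgodic.IsAsymptoticEntranceDensity T μ Y H)
    (c : ℕ → ℝ) (hc_pos : ∀ n, 0 < c n) (hc_zero : Tendsto c atTop (𝓝 0))
    (hc_top : Tendsto (fun n : ℕ => c n * n) atTop atTop) :
    (fun n : ℕ => (InfiniteErgodic.densityMeasure μ H).real
        {x | (InfiniteErgodic.lastVisit T Y n x : ℝ) / n ≤ c n}) ~[atTop]
      fun n : ℕ => Real.sin (Real.pi * α) / (Real.pi * α) *
        (c n ^ α * ℓ n / ℓ (c n * n)) := by
  open InfiniteErgodic in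
  have hTμ : MeasurePreserving T μ μ := hT.ergodic.toMeasurePreserving
  obtain ⟨N, -, hsw⟩ := hsweep
  have hreg := isRegularRate_wanderingRate hTμ hY hY_fin hα_pos hα_lt hℓ hw
  have hfin := hH.isFiniteMeasure hTμ hY hY_pos hY_fin
  set ν := densityMeasure μ H with hν
  set x : ℕ → ℝ := fun n => c n * n with hx_def
  have hx : Tendsto x atTop atTop := hc_top
  have hxn : Tendsto (fun n : ℕ => x n / n) atTop (𝓝 0) := by
    refine hc_zero.congr' ?_
    filter_upwards [eventually_gt_atTop 0] with n hn
    have : (n : ℝ) ≠ 0 := by positivity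
    simp only [hx_def]; field_simp
  have hx0 : ∀ n, 0 ≤ x n := fun n => mul_nonneg (hc_pos n).le (Nat.cast_nonneg n)
  -- `ρ n` is the order of magnitude of the probability in question.
  set ρ : ℕ → ℝ := fun n => x n * ((1 - α) * ((n : ℝ) ^ (1 - α) * ℓ n) / n) /
    (x n ^ (1 - α) * ℓ (x n)) with hρ
  have hρpos : ∀ᶠ n in atTop, 0 < ρ n := by
    filter_upwards [hx.eventually_gt_atTop 0, eventually_gt_atTop 0] with n hn hn0
    have hn' : (0 : ℝ) < n := by exact_mod_cast hn0
    have h1 := hℓ.pos _ hn'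
    have h2 := hℓ.pos _ hn
    have h3 : 0 < 1 - α := by linarith
    positivity
  set ψ : ℕ → ℝ := fun n => ν.real {x | (lastVisit T Y n x : ℝ) / n ≤ c n} / ρ n with hψ
  set A : ℝ := 1 / (Real.Gamma (2 - α) * Real.Gamma (α + 1)) with hA_def
  have hG1 : 0 < Real.Gamma (2 - α) := Real.Gamma_pos_of_pos (by linarith)
  have hG2 : 0 < Real.Gamma (α + 1) := Real.Gamma_pos_of_pos (by linarith)
  have hA : 0 < A := by positivity
  have hset : ∀ n, 0 < n → {y | (lastVisit T Y n y : ℝ) / n ≤ c n} =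
      {y | ∀ k ≤ n, T^[k] y ∈ Y → (k : ℝ) ≤ x n} := by
    intro n hn
    have hn' : (0 : ℝ) < n := by exact_mod_cast hn
    ext y
    simp only [Set.mem_ofPred_eq, div_le_iff₀ hn']
    exact lastVisit_le_iff (hx0 n)
  -- the averages of the normalised `ν (noVisit i (b n))` over the window `i / x n ∈ (u, v)`; the absolute
  -- value matters only for the finitely many `n` at which `ρ n` may fail to be positive
  have hwin : ∀ b : ℕ → ℕ, Tendsto (fun n : ℕ => (b n : ℝ) / n) atTop (𝓝 1) → ∀ u v : ℝ, 0 < u →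
      u < v → ∃ L, A * u ^ α ≤ L ∧ L ≤ A * v ^ α ∧ ∀ B,
      ((∀ᶠ n in atTop, ∀ i : ℕ, u ≤ i / x n → i / x n ≤ v →
        ψ n / x n ≤ |(x n * ρ n)⁻¹| * ν.real (noVisit T Y i (b n))) →
          L < B → ∀ᶠ n in atTop, ψ n ≤ B) ∧
      ((∀ᶠ n in atTop, ∀ i : ℕ, u ≤ i / x n → i / x n ≤ v →
        |(x n * ρ n)⁻¹| * ν.real (noVisit T Y i (b n)) ≤ ψ n / x n) →
          B < L → ∀ᶠ n in atTop, B ≤ ψ n) := by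
    intro b hb u v hu huv
    have hsum : ∀ᶠ n in atTop, Summable fun i : ℕ =>
        Real.exp (-(i / x n)) * (|(x n * ρ n)⁻¹| * ν.real (noVisit T Y i (b n))) := by
      filter_upwards [(tendsto_laplace_noVisit hTμ hY hY_pos hY_fin hreg hH hsw hx hxn hb
        one_pos).1] with n hn
      refine (hn.mul_left |(x n * ρ n)⁻¹|).congr fun i => ?_
      rw [one_mul]; ring
    have hlap : ∀ k : ℕ, Tendsto (fun n => ∑' i : ℕ, Real.exp (-((k + 1 : ℝ) * (i / x n))) *
        (|(x n * ρ n)⁻¹| * ν.real (noVisit T Y i (b n)))) atTop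
        (𝓝 (A * (Real.Gamma (α + 1) / (k + 1 : ℝ) ^ (α + 1)))) := by
      intro k
      have hk : (0 : ℝ) < k + 1 := by positivity
      have h1 := (tendsto_laplace_noVisit hTμ hY hY_pos hY_fin hreg hH hsw hx hxn hb hk).2
      have e : 1 / (k + 1 : ℝ) ^ 2 / (Real.Gamma (2 - α) / (k + 1 : ℝ) ^ (1 - α)) =
          A * (Real.Gamma (α + 1) / (k + 1 : ℝ) ^ (α + 1)) := by
        have h2 : (k + 1 : ℝ) ^ 2 = (k + 1 : ℝ) ^ (α + 1) * (k + 1 : ℝ) ^ (1 - α) := by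
          rw [← Real.rpow_add hk, ← Real.rpow_two]; congr 1; ring
        have h3 := (Real.rpow_pos_of_pos hk (1 - α)).ne'
        have h4 := (Real.rpow_pos_of_pos hk (α + 1)).ne'
        rw [h2, hA_def]
        field_simp
      rw [e] at h1
      refine h1.congr' ?_
      filter_upwards [hρpos, hx.eventually_gt_atTop 0] with n hn hn0
      rw [abs_of_pos (inv_pos.2 (mul_pos hn0 hn)), ← tsum_mul_right]
      refine tsum_congr fun i => ?_
      have : (x n ^ (1 - α) * ℓ (x n)) / (x n ^ 2 * ((1 - α) * ((n : ℝ) ^ (1 - α) * ℓ n) / n)) =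
          (x n * ρ n)⁻¹ := by
        simp only [hρ]
        rw [← mul_div_assoc (x n) _ (x n ^ (1 - α) * ℓ (x n)), inv_div, ← mul_assoc (x n), ← pow_two]
      rw [this]; ring
    obtain ⟨L, hL1, hL2, hL3⟩ := exists_bump_ratio hα_pos.le hA.le hx
      (fun n i => mul_nonneg (abs_nonneg _) measureReal_nonneg) hsum hlap hu huv
    exact ⟨L, hL1, hL2, hL3 ψ⟩
  have hlim : Tendsto ψ atTop (𝓝 A) := by
    have hcont : ContinuousAt (fun t : ℝ => A * t ^ α) 1 :=
      continuousAt_const.mul (Real.continuousAt_rpow_const 1 α (Or.inl one_ne_zero))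
    have hcont' := hcont.tendsto
    rw [Real.one_rpow, mul_one] at hcont'
    have hpt : ∀ n i, 0 < ρ n → 0 < x n → (x n * ρ n)⁻¹ * i = i / ρ n / x n := by
      intro n i h1 h2; field_simp
    refine tendsto_order.2 ⟨fun B hB => ?_, fun B hB => ?_⟩
    · -- for `i ≤ x n`, not visiting `Y` in `(i, i + n]` forces the last visit up to
      -- time `n` to be at most `x n`
      obtain ⟨B', hB', hB'A⟩ := exists_between hB
      obtain ⟨u, ⟨hu1, hu2⟩, hu3⟩ : ∃ u : ℝ, (B' < A * u ^ α ∧ 0 < u) ∧ u < 1 := by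
        have h1 := (hcont'.mono_left nhdsWithin_le_nhds).eventually_const_lt hB'A
          (l := 𝓝[<] 1)
        have h2 : ∀ᶠ u : ℝ in 𝓝[<] 1, 0 < u :=
          nhdsWithin_le_nhds (eventually_gt_nhds one_pos)
        exact ((h1.and h2).and self_mem_nhdsWithin).exists
      have hb : Tendsto (fun n : ℕ => ((n : ℕ) : ℝ) / n) atTop (𝓝 1) := by
        refine tendsto_const_nhds.congr' ?_
        filter_upwards [eventually_gt_atTop 0] with n hn
        rw [div_self]; positivity
      obtain ⟨L, hL1, -, hL3⟩ := hwin (fun n => n) hb u 1 hu2 hu3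
      filter_upwards [(hL3 B').2 (by
        filter_upwards [hρpos, hx.eventually_gt_atTop 0, eventually_gt_atTop 0]
          with n h1 h2 h3 i _ hi
        rw [abs_of_pos (inv_pos.2 (mul_pos h2 h1)), hpt n _ h1 h2]
        simp only [hψ, hset n h3]
        refine div_le_div_of_nonneg_right (div_le_div_of_nonneg_right
          (measureReal_mono fun y hy k hk hkY => ?_) h1.le) h2.le
        rw [div_le_one h2] at hi
        by_contra hcon
        push Not at hcon
        exact hy k (by exact_mod_cast hi.trans_lt hcon) (by omega) hkY) (hu1.trans_le hL1)]
        with n hn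
      exact hB'.trans_le hn
    · -- for `x n ≤ i ≤ 2 * x n`, a last visit at most `x n` means no visit in `(i, n]`, which contains
      -- the window of length `n - ⌈2 * x n⌉₊` after `i`
      obtain ⟨B', hB'A, hB'⟩ := exists_between hB
      obtain ⟨v, ⟨hv1, hv2⟩, hv3⟩ : ∃ v : ℝ, (A * v ^ α < B' ∧ v < 2) ∧ 1 < v := by
        have h1 := (hcont'.mono_left nhdsWithin_le_nhds).eventually_lt_const hB'A
          (l := 𝓝[>] 1)
        have h2 : ∀ᶠ u : ℝ in 𝓝[>] 1, u < 2 :=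
          nhdsWithin_le_nhds (eventually_lt_nhds one_lt_two)
        exact ((h1.and h2).and self_mem_nhdsWithin).exists
      have h2x : Tendsto (fun n => 2 * x n) atTop atTop := hx.const_mul_atTop two_pos
      have hceil : Tendsto (fun n : ℕ => (⌈2 * x n⌉₊ : ℝ) / n) atTop (𝓝 0) := by
        have h1 := ((tendsto_nat_ceil_div_atTop (R := ℝ)).comp h2x).mul (hxn.const_mul 2)
        rw [mul_zero, mul_zero] at h1
        refine h1.congr' ?_
        filter_upwards [h2x.eventually_gt_atTop 0] with n hn
        simp only [Function.comp]
        rw [← mul_div_assoc, div_mul_div_cancel₀ hn.ne']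
      have hle : ∀ᶠ n : ℕ in atTop, ⌈2 * x n⌉₊ ≤ n := by
        filter_upwards [hceil.eventually_lt_const one_pos, eventually_gt_atTop 0] with n hn hn0
        rw [div_lt_one (by exact_mod_cast hn0)] at hn
        exact_mod_cast hn.le
      have hb : Tendsto (fun n : ℕ => ((n - ⌈2 * x n⌉₊ : ℕ) : ℝ) / n) atTop (𝓝 1) := by
        have h1 := hceil.const_sub 1
        rw [sub_zero] at h1
        refine h1.congr' ?_
        filter_upwards [hle, eventually_gt_atTop 0] with n hn hn0
        have : (n : ℝ) ≠ 0 := by positivity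
        rw [Nat.cast_sub hn]; field_simp
      obtain ⟨L, -, hL2, hL3⟩ := hwin (fun n => n - ⌈2 * x n⌉₊) hb 1 v one_pos hv3
      filter_upwards [(hL3 B').1 (by
        filter_upwards [hρpos, hx.eventually_gt_atTop 0, eventually_gt_atTop 0, hle]
          with n h1 h2 h3 h4 i hi1 hi2
        rw [abs_of_pos (inv_pos.2 (mul_pos h2 h1)), hpt n _ h1 h2]
        simp only [hψ, hset n h3]
        refine div_le_div_of_nonneg_right (div_le_div_of_nonneg_right
          (measureReal_mono fun y hy k hk1 hk2 hkY => ?_) h1.le) h2.le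
        rw [one_le_div h2] at hi1
        have hi3 : i ≤ ⌈2 * x n⌉₊ := by
          have : (i : ℝ) ≤ ⌈2 * x n⌉₊ := by
            rw [div_le_iff₀ h2] at hi2
            exact (hi2.trans (by gcongr)).trans (Nat.le_ceil _)
          exact_mod_cast this
        have h5 := hy k (by omega) hkY
        have h6 : (k : ℝ) ≤ i := h5.trans hi1
        have h7 : k ≤ i := by exact_mod_cast h6
        omega) (hL2.trans_lt hv1)] with n hn
      exact hn.trans_lt hB'
  refine isEquivalent_of_tendsto_one ?_
  have hfinal := hlim.div_const A
  rw [div_self hA.ne'] at hfinal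
  refine hfinal.congr' ?_
  filter_upwards [hρpos, hx.eventually_gt_atTop 0, eventually_gt_atTop 0] with n h1 h2 h3
  have hn' : (0 : ℝ) < n := by exact_mod_cast h3
  rw [Pi.div_apply]
  simp only [hψ]
  rw [div_div]
  congr 1
  rw [← gamma_constant_eq hα_pos hα_lt]
  have hxpow : x n = x n ^ α * x n ^ (1 - α) := by
    rw [← Real.rpow_add h2, add_sub_cancel, Real.rpow_one]
  have hnpow : (n : ℝ) = (n : ℝ) ^ α * (n : ℝ) ^ (1 - α) := by
    rw [← Real.rpow_add hn', add_sub_cancel, Real.rpow_one]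
  have hcpow : c n ^ α = x n ^ α / (n : ℝ) ^ α := by
    rw [← Real.div_rpow h2.le hn'.le]
    congr 1
    simp only [hx_def]; field_simp
  have p1 := (Real.rpow_pos_of_pos h2 (1 - α)).ne'
  have p2 := (Real.rpow_pos_of_pos hn' (1 - α)).ne'
  have p3 := (Real.rpow_pos_of_pos hn' α).ne'
  have p4 := (hℓ.pos _ h2).ne'
  have hρ' : ρ n = (1 - α) * (x n ^ α / (n : ℝ) ^ α) * ℓ n / ℓ (x n) := by
    have e1 : ρ n = (1 - α) * (x n / x n ^ (1 - α)) * ((n : ℝ) ^ (1 - α) / n) * ℓ n / ℓ (x n) := by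
      simp only [hρ]; field_simp
    have e2 : x n / x n ^ (1 - α) = x n ^ α := by
      rw [div_eq_iff p1]; exact hxpow
    have e3 : (n : ℝ) ^ (1 - α) / n = ((n : ℝ) ^ α)⁻¹ := by
      rw [div_eq_iff hn'.ne', eq_inv_mul_iff_mul_eq₀ p3]; exact hnpow.symm
    rw [e1, e2, e3]; ring
  rw [hρ', hcpow]
  ring
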